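/- Let $\mathbb R^{4,2}$ be $\mathbb R^6$ with $\langle v,w\rangle=v_1w_1+\dots+v_4w_4-v_5w_5-v_6w_6$, and put $\mathbf e_0=\frac12(\mathbf e_5-\mathbf e_4)$, $\mathbf e_\infty=\frac12(\mathbf e_5+\mathbf e_4)$, $\mathbf e_r=\mathbf e_6$. A generalized oriented sphere is a point $[\widehat s]$ of the Lie quadric $\langle\widehat s,\widehat s\rangle=0$; a sphere with centre $c\in\mathbb R^3$ and oriented radius $r$ has normalized coordinates $c+\mathbf e_0+(\|c\|^2-r^2)\mathbf e_\infty+r\mathbf e_r$ (points of $\mathbb R^3$ are the case $r=0$), and $[\mathbf e_\infty]$ is the point $\infty$. A contact element is a projective line contained in the Lie quadric; for $x\in\mathbb R^3$ and a unit vector $n$, the contact element of $(x,n)$ is spanned by $x+\mathbf e_0+\|x\|^2\mathbf e_\infty$ and the plane $n+2\langle n,x\rangle\mathbf e_\infty+\mathbf e_r$. A Dupin cyclide $\mathcal C$ is given by two mutually polar planes $P^{(1)},P^{(2)}$ of signature $(++-)$ in $\mathbb{RP}^5$; its cyclidic families are the conics $\mathcal C^{(i)}$ in which $P^{(i)}$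 meets the Lie quadric, its contact elements are the lines $\mathrm{inc}[s^{(1)},s^{(2)}]$ spanned by $s^{(i)}\in\mathcal C^{(i)}$, and its points are the point spheres in these lines. Theorem. For $i=1,2$ let $\widehat s^{(i)}_1,\widehat s^{(i)}_2,\widehat s^{(i)}_3$ be homogeneous coordinates (for instance normalized ones) of three different spheres of $\mathcal C^{(i)}$, let $a^{(i)}_{jk}=\langle\widehat s^{(i)}_j,\widehat s^{(i)}_k\rangle$, and put $$\widehat s^{(i)}(t)=a^{(i)}_{23}(2t^2-3t+1)\,\widehat s^{(i)}_1+a^{(i)}_{13}(t-t^2)\,\widehat s^{(i)}_2+a^{(i)}_{12}(2t^2-t)\,\widehat s^{(i)}_3 ,$$ with the coefficient of $t^2$ as the value at $t=\infty$. Let $r^{(i)}(t)$ and $\mu^{(i)}(t)$ be the $\mathbf e_r$- and the $\mathbf e_0$-component of $\widehat s^{(i)}(t)$ (with respect to $\mathbf e_1,\mathbf e_2,\mathbf e_3,\mathbf e_0,\mathbf e_\infty,\mathbf e_r$), that is, $$r^{(i)}(t)=(\widehat s^{(i)}_1)_r\,a^{(i)}_{23}(2t^2-3t+1)+(\widehat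 s^{(i)}_2)_r\,a^{(i)}_{13}(t-t^2)+(\widehat s^{(i)}_3)_r\,a^{(i)}_{12}(2t^2-t),$$ and likewise for $\mu^{(i)}$ with $\mathbf e_0$-components. Write $\widehat{\mathbb R}=\mathbb R\cup\{\infty\}$, with the charts $t$ and $1/t$. Then: (1) $s^{(i)}=[\widehat s^{(i)}]$ is a well-defined bijection $\widehat{\mathbb R}\to\mathcal C^{(i)}$ with $0\mapsto s^{(i)}_1$, $\frac12\mapsto s^{(i)}_2$, $1\mapsto s^{(i)}_3$. If $\mu^{(i)}(t)\neq0$, then $s^{(i)}(t)$ is the sphere with normalized coordinates $\widehat s^{(i)}(t)/\mu^{(i)}(t)$ and oriented radius $r^{(i)}(t)/\mu^{(i)}(t)$. (2) $L(t_1,t_2)=\mathrm{inc}[s^{(1)}(t_1),s^{(2)}(t_2)]$ is a bijection from $\widehat{\mathbb R}\times\widehat{\mathbb R}$ onto the contact elements of $\mathcal C$, and it is a Lie geometric curvature line parametrization: a smooth Legendre immersion for which $s^{(1)}(t_1)$ is the curvature sphere in the direction of $t_2$ and $s^{(2)}(t_2)$ is the curvature sphere in the direction of $t_1$. (3) The unique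 point sphere in $L(t_1,t_2)$ is $[\,r^{(2)}(t_2)\widehat s^{(1)}(t_1)-r^{(1)}(t_1)\widehat s^{(2)}(t_2)\,]$. It is $\infty$ if $\nu(t_1,t_2)=r^{(2)}(t_2)\mu^{(1)}(t_1)-r^{(1)}(t_1)\mu^{(2)}(t_2)$ vanishes, and otherwise it is a point $x(t_1,t_2)\in\mathbb R^3$ with normalized coordinates $$\widehat x(t_1,t_2)=\frac{r^{(2)}(t_2)\,\widehat s^{(1)}(t_1)-r^{(1)}(t_1)\,\widehat s^{(2)}(t_2)}{r^{(2)}(t_2)\,\mu^{(1)}(t_1)-r^{(1)}(t_1)\,\mu^{(2)}(t_2)} .$$ If $\mu^{(1)}(t_1)\ne0$ and $\mu^{(2)}(t_2)\neq0$, then $\nu(t_1,t_2)\ne0$, the oriented radii $r_i=r^{(i)}(t_i)/\mu^{(i)}(t_i)$ are different, and with the normalized coordinates $\widehat s_i=\widehat s^{(i)}(t_i)/\mu^{(i)}(t_i)$ one has $\widehat x=(r_2\widehat s_1-r_1\widehat s_2)/(r_2-r_1)$. (4) The points $x(t_1,t_2)$ (first three components of $\widehat x$), $\nu(t_1,t_2)\neq0$,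 are exactly the points of $\mathcal C$ in $\mathbb R^3$. There are unit vectors $n(t_1,t_2)$ such that $L(t_1,t_2)$ is the contact element of $(x,n)$. The map $x$ is smooth where $\nu\ne0$, and there $x$ is, with unit normal $n$, an immersed curvature line parametrization (parameter lines orthogonal and in principal directions) exactly at those $(t_1,t_2)$ for which neither $s^{(1)}(t_1)$ nor $s^{(2)}(t_2)$ is a point sphere. If the family $\mathcal C^{(i)}$ does not consist of point spheres only, then $s^{(i)}(t)$ is a point sphere for only finitely many $t\in\widehat{\mathbb R}$. -/

import Mathlib

namespace LieCyclide

open scoped LinearAlgebra.Projectivization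

/-- Euclidean three-space. -/
abbrev E3 : Type := EuclideanSpace ℝ (Fin 3)

/-- Homogeneous coordinates: the real vector space of dimension six. -/
abbrev V : Type := Fin 6 → ℝ

/-- The inner product of signature `(4, 2)` on `V`. -/
noncomputable def lieForm : LinearMap.BilinForm ℝ V :=
  Matrix.toBilin' (Matrix.diagonal ![1, 1, 1, 1, -1, -1])

/-! The basis `e₁, e₂, e₃, e₀, e∞, e_r` with `e₀ = (e₅ - e₄) / 2`, `e∞ = (e₅ + e₄) / 2`, `e_r = e₆`. -/

/-- The embedding of Euclidean space as the span of the first three basis vectors. -/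
def embed (c : E3) : V := ![c 0, c 1, c 2, 0, 0, 0]

noncomputable def eZero : V := ![0, 0, 0, -1 / 2, 1 / 2, 0]

noncomputable def eInf : V := ![0, 0, 0, 1 / 2, 1 / 2, 0]

def eR : V := ![0, 0, 0, 0, 0, 1]

/-- First three components. -/
noncomputable def spatial (v : V) : E3 := !₂[v 0, v 1, v 2]

/-- The `e₀`-component with respect to the basis `e₁, e₂, e₃, e₀, e∞, e_r`. -/
def compZero (v : V) : ℝ := v 4 - v 3

/-- The `e_r`-component with respect to the basis `e₁, e₂, e₃, e₀, e∞, e_r`. -/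
def compR (v : V) : ℝ := v 5

/-- Normalized coordinates of the oriented sphere with centre `c` and oriented radius `r`
(positive radius: inward unit normals). -/
noncomputable def sphereVec (c : E3) (r : ℝ) : V :=
  embed c + eZero + (‖c‖ ^ 2 - r ^ 2) • eInf + r • eR

/-- Normalized coordinates of a point, regarded as a sphere of radius zero. -/
noncomputable def pointVec (x : E3) : V := embed x + eZero + ‖x‖ ^ 2 • eInf

/-- Normalized coordinates of the oriented plane `⟪n, x⟫ = d` with unit normal `n`. -/
noncomputable def planeVec (n : E3) (d : ℝ) : V := embed n + (2 * d) • eInf + eR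

/-- A point sphere (a point of `ℝ³ ∪ {∞}`): an isotropic point with vanishing `e_r`-component. -/
def IsPointSphere (p : ℙ ℝ V) : Prop := lieForm p.rep p.rep = 0 ∧ compR p.rep = 0

/-- A contact element: a projective line contained in the Lie quadric. -/
def IsContactElement (W : Submodule ℝ V) : Prop :=
  Module.finrank ℝ W = 2 ∧ ∀ v ∈ W, lieForm v v = 0

/-- The smallest projective subspace that contains `p` and `q`. -/
noncomputable def inc (p q : ℙ ℝ V) : Submodule ℝ V := p.submodule ⊔ q.submodule

/-- The contact element of all oriented spheres through the point `x` with unit normal `n` at `x`.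
It is spanned by the point `x` and by the oriented plane through `x` with normal `n`; its proper
spheres are those with centre `x + r • n` and oriented radius `r`. -/
noncomputable def contactElementAt (x n : E3) : Submodule ℝ V :=
  Submodule.span ℝ {pointVec x, planeVec n (inner ℝ n x)}

/-- The restriction of `lieForm` to `W` is nondegenerate of signature `(+ + -)`; in particular
`W` has dimension three, that is, it is a projective plane. -/
def HasSignaturePPM (W : Submodule ℝ V) : Prop :=
  ∃ b : Module.Basis (Fin 3) ℝ W, ∀ i j, lieForm (b i) (b j) =
    if i = j then (![1, 1, -1] : Fin 3 → ℝ) i else 0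

/-- A Dupin cyclide, as a decomposition of homogeneous coordinate space into two planes of
signature `(+ + -)` that are polar to each other. -/
structure DupinCyclide where
  P : Fin 2 → Submodule ℝ V
  signature : ∀ i, HasSignaturePPM (P i)
  polar : P 1 = lieForm.orthogonal (P 0)

/-- The two cyclidic families of oriented spheres: the conics in which the two planes intersect
the Lie quadric. -/
def DupinCyclide.family (D : DupinCyclide) (i : Fin 2) : Set (ℙ ℝ V) :=
  {p | p.submodule ≤ D.P i ∧ lieForm p.rep p.rep = 0}

/-- The contact elements of the cyclide. -/
def DupinCyclide.contactElements (D : DupinCyclide) : Set (Submodule ℝ V) :=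
  {W | ∃ p ∈ D.family 0, ∃ q ∈ D.family 1, W = inc p q}

/-- The points of the cyclide in Euclidean space: the (finite) contact points of its contact
elements. -/
def DupinCyclide.points (D : DupinCyclide) : Set E3 :=
  {x | ∃ W ∈ D.contactElements, pointVec x ∈ W}

/-! ### The quadratic parametrization of a conic through three points -/

/-- The polynomials `2t² - 3t + 1`, `t - t²`, `2t² - t`, and for `t = ∞` their leading
coefficients. -/
noncomputable def quadCoeff : OnePoint ℝ → Fin 3 → ℝ
  | none => ![2, -1, 2]
  | some t => ![2 * t ^ 2 - 3 * t + 1, t - t ^ 2, 2 * t ^ 2 - t]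

/-- The weights `a₂₃, a₁₃, a₁₂`, where `a_{jk}` is the product of `S_j` and `S_k`. -/
noncomputable def weight (S : Fin 3 → V) : Fin 3 → ℝ :=
  ![lieForm (S 1) (S 2), lieForm (S 0) (S 2), lieForm (S 0) (S 1)]

/-- The quadratic parametrization
`a₂₃ (2t² - 3t + 1) S₁ + a₁₃ (t - t²) S₂ + a₁₂ (2t² - t) S₃`. -/
noncomputable def conicVec (S : Fin 3 → V) (t : OnePoint ℝ) : V :=
  ∑ j, (weight S j * quadCoeff t j) • S j

/-- The quadratic radius function
`(S₁)_r a₂₃ (2t² - 3t + 1) + (S₂)_r a₁₃ (t - t²) + (S₃)_r a₁₂ (2t² - t)`. -/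
noncomputable def radiusFun (S : Fin 3 → V) (t : OnePoint ℝ) : ℝ :=
  ∑ j, compR (S j) * weight S j * quadCoeff t j

/-- The corresponding quadratic function for the `e₀`-components. -/
noncomputable def scaleFun (S : Fin 3 → V) (t : OnePoint ℝ) : ℝ :=
  ∑ j, compZero (S j) * weight S j * quadCoeff t j

/-- `r⁽²⁾(t₂) ŝ⁽¹⁾(t₁) - r⁽¹⁾(t₁) ŝ⁽²⁾(t₂)`. -/
noncomputable def contactVec (S : Fin 2 → Fin 3 → V) (t₁ t₂ : OnePoint ℝ) : V :=
  radiusFun (S 1) t₂ • conicVec (S 0) t₁ - radiusFun (S 0) t₁ • conicVec (S 1) t₂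

/-- `r⁽²⁾(t₂) μ⁽¹⁾(t₁) - r⁽¹⁾(t₁) μ⁽²⁾(t₂)`, where `μ⁽ⁱ⁾` is the `e₀`-component of `ŝ⁽ⁱ⁾`. -/
noncomputable def contactScale (S : Fin 2 → Fin 3 → V) (t₁ t₂ : OnePoint ℝ) : ℝ :=
  radiusFun (S 1) t₂ * scaleFun (S 0) t₁ - radiusFun (S 0) t₁ * scaleFun (S 1) t₂

/-- The induced parametrization `x̂` in normalized homogeneous coordinates. -/
noncomputable def xHat (S : Fin 2 → Fin 3 → V) (t₁ t₂ : OnePoint ℝ) : V :=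
  (contactScale S t₁ t₂)⁻¹ • contactVec S t₁ t₂

/-- The Euclidean parametrization: the first three components of `x̂`. -/
noncomputable def xPoint (S : Fin 2 → Fin 3 → V) (t₁ t₂ : OnePoint ℝ) : E3 :=
  spatial (xHat S t₁ t₂)

/-! ### Curvature line parametrizations -/

/-- The two standard charts `t ↦ t` and `u ↦ 1 / u` (with `0 ↦ ∞`) of `ℝ ∪ {∞}`. -/
noncomputable def chart : Fin 2 → ℝ → OnePoint ℝ
  | 0, t => (t : OnePoint ℝ)
  | 1, u => if u = 0 then OnePoint.infty else ((u⁻¹ : ℝ) : OnePoint ℝ)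

/-- Derivative with respect to the first parameter. -/
noncomputable def d₁ {F : Type*} [NormedAddCommGroup F] [NormedSpace ℝ F]
    (f : ℝ × ℝ → F) (p : ℝ × ℝ) : F := fderiv ℝ f p (1, 0)

/-- Derivative with respect to the second parameter. -/
noncomputable def d₂ {F : Type*} [NormedAddCommGroup F] [NormedSpace ℝ F]
    (f : ℝ × ℝ → F) (p : ℝ × ℝ) : F := fderiv ℝ f p (0, 1)

/-- At the parameter `p`, the smooth two-parameter family `L` of contact elements is a Legendre
immersion, and both coordinate directions are curvature directions, with (distinct) curvature
spheres `K₂` for the direction of the first and `K₁` for the direction of the second parameter.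
A sphere `[σ p] ⊂ L p` is a curvature sphere for a direction when the derivative of `σ` in this
direction lies in `L p`; modulo `L p` this derivative depends only on `σ p`, not on the section
`σ` of `L`. -/
def IsLieCurvatureLineParamAt (L : ℝ × ℝ → Submodule ℝ V) (K₁ K₂ : ℙ ℝ V) (p : ℝ × ℝ) : Prop :=
  ∃ σ τ : ℝ × ℝ → V,
    ContDiffAt ℝ ((⊤ : ℕ∞) : WithTop ℕ∞) σ p ∧ ContDiffAt ℝ ((⊤ : ℕ∞) : WithTop ℕ∞) τ p ∧
    (∀ᶠ q in nhds p, LinearIndependent ℝ ![σ q, τ q] ∧ L q = Submodule.span ℝ {σ q, τ q} ∧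
      IsContactElement (L q)) ∧
    -- contact condition
    (∀ X : ℝ × ℝ, lieForm (fderiv ℝ σ p X) (τ p) = 0) ∧
    -- immersion
    (∀ X : ℝ × ℝ, fderiv ℝ σ p X ∈ L p → fderiv ℝ τ p X ∈ L p → X = 0) ∧
    -- curvature spheres
    K₁.submodule = Submodule.span ℝ {σ p} ∧ d₂ σ p ∈ L p ∧
    K₂.submodule = Submodule.span ℝ {τ p} ∧ d₁ τ p ∈ L p

/-- At the parameter `p`, the map `f` with smooth unit normal field `n` is an immersed smooth
surface whose parameter lines are curvature lines: they are orthogonal, and they satisfy the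
equations of Rodrigues, that is, the coordinate directions are principal directions. -/
def IsCurvatureLineParamAt (f n : ℝ × ℝ → E3) (p : ℝ × ℝ) : Prop :=
  ContDiffAt ℝ ((⊤ : ℕ∞) : WithTop ℕ∞) f p ∧ ContDiffAt ℝ ((⊤ : ℕ∞) : WithTop ℕ∞) n p ∧
  (∀ᶠ q in nhds p, ‖n q‖ = 1 ∧ inner ℝ (n q) (d₁ f q) = 0 ∧ inner ℝ (n q) (d₂ f q) = 0) ∧
  LinearIndependent ℝ ![d₁ f p, d₂ f p] ∧
  inner ℝ (d₁ f p) (d₂ f p) = 0 ∧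
  ∃ κ₁ κ₂ : ℝ, d₁ n p = -κ₁ • d₁ f p ∧ d₂ n p = -κ₂ • d₂ f p

end LieCyclide

open LieCyclide
open scoped LinearAlgebra.Projectivization

namespace LieCyclide

open scoped LinearAlgebra.Projectivization

/-! ### The Lie form in coordinates -/

/-! Each family is treated in its own plane first. A space of signature (+ + -) contains no
isotropic plane, so three different points of its conic have nonzero mutual products and their
vectors form a basis (`HasSignaturePPM.isConicTriple`). If the basis vectors are rescaled by the
weights `a₂₃, a₁₃, a₁₂`, the form becomes a constant multiple of `x₀x₁ + x₀x₂ + x₁x₂`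
(`IsConicTriple.lieForm_weighted`). The spheres have dropped out, and it remains to parametrize one
model conic by `quadCoeff`, whose inverse is a quotient of two linear forms.

By polarity, vectors `u` and `v` from the two conics are orthogonal and independent, so they span a
contact element (`DupinCyclide.spansContact`). It meets each plane only in the line of `u` or of
`v`, which makes the parametrization of the contact elements injective. The equation of vanishing
`e_r`-component has the solution `pointComb u v`, unique up to scale because the hyperplane `e_r =
0` has signature (4, 1) and contains no contact element. If this solution is not `∞`, the contact
element has a basis of a normalized point `x̂` and a plane `n̂`, in which a sphere has its `e₀`- and
`e_r`-components as coordinates: `v = μ x̂ + r n̂`.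

The differential geometry uses that `u` depends on the first parameter only and `v` on the second
only. Hence each is a curvature sphere for the direction in which it rests. Differentiating `v = μ
x̂ + r n̂` with `v` fixed gives the equation of Rodrigues (`rodrigues`). Up to vectors of the
contact element, the derivative of `x̂` along the first parameter is `(r(v) / ν) u'`. Since `u'` is
orthogonal to the contact element and to `v'`, and `⟨u', u'⟩ ≠ 0`, the parameter lines are
orthogonal, and this derivative vanishes exactly when `v` is a point sphere (`ContactMotion`). The
value `t = ∞` is handled by a denominator-free representative in each chart, because points and
normals do not depend on the scale of `u` and `v`. -/

theorem lieForm_apply (u v : V) : lieForm u v =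
    u 0 * v 0 + u 1 * v 1 + u 2 * v 2 + u 3 * v 3 - u 4 * v 4 - u 5 * v 5 := by
  simp only [lieForm, Matrix.toBilin'_apply', Matrix.mulVec_diagonal, dotProduct,
    Fin.sum_univ_succ]
  simp
  ring

theorem lieForm_comm (u v : V) : lieForm u v = lieForm v u := by
  simp only [lieForm_apply]; ring

theorem compR_add (u v : V) : compR (u + v) = compR u + compR v := rfl
theorem compR_sub (u v : V) : compR (u - v) = compR u - compR v := rfl
theorem compR_smul (a : ℝ) (u : V) : compR (a • u) = a * compR u := rfl

theorem compZero_add (u v : V) : compZero (u + v) = compZero u + compZero v := by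
  simp [compZero]; ring
theorem compZero_sub (u v : V) : compZero (u - v) = compZero u - compZero v := by
  simp [compZero]; ring
theorem compZero_smul (a : ℝ) (u : V) : compZero (a • u) = a * compZero u := by
  simp [compZero]; ring

/-- Contact with `∞` thus characterizes the spheres without `e₀`-component. -/
theorem lieForm_eInf (v : V) : lieForm eInf v = -compZero v / 2 := by
  simp [lieForm_apply, eInf, compZero]; ring

theorem norm_sq_E3 (c : E3) : ‖c‖ ^ 2 = c 0 ^ 2 + c 1 ^ 2 + c 2 ^ 2 := by
  simp [EuclideanSpace.norm_sq_eq, Fin.sum_univ_succ]; ring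

theorem inner_E3 (x y : E3) : inner ℝ x y = x 0 * y 0 + x 1 * y 1 + x 2 * y 2 := by
  simp [PiLp.inner_apply, Fin.sum_univ_succ]; ring

@[simp] theorem spatial_zero (v : V) : spatial v 0 = v 0 := rfl
@[simp] theorem spatial_one (v : V) : spatial v 1 = v 1 := rfl
@[simp] theorem spatial_two (v : V) : spatial v 2 = v 2 := rfl

theorem compR_pointVec (x : E3) : compR (pointVec x) = 0 := by
  simp [compR, pointVec, embed, eZero, eInf]

theorem compZero_pointVec (x : E3) : compZero (pointVec x) = 1 := by
  simp [compZero, pointVec, embed, eZero, eInf]; ring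

theorem spatial_pointVec (x : E3) : spatial (pointVec x) = x := by
  ext i; fin_cases i <;> simp [spatial, pointVec, embed, eZero, eInf]

/-- An isotropic vector with `e₀`-component one is in normalized coordinates. -/
theorem eq_sphereVec {v : V} (hv : lieForm v v = 0) (h0 : compZero v = 1) :
    v = sphereVec (spatial v) (compR v) := by
  rw [lieForm_apply] at hv
  simp only [compZero] at h0
  have h4 : v 4 = 1 + v 3 := by linarith
  rw [h4] at hv
  ext i; fin_cases i <;>
    simp [sphereVec, embed, eZero, eInf, eR, norm_sq_E3, compR] <;> nlinarith

theorem sphereVec_zero (c : E3) : sphereVec c 0 = pointVec c := by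
  simp [sphereVec, pointVec]

theorem eq_pointVec {v : V} (hv : lieForm v v = 0) (h0 : compZero v = 1) (hr : compR v = 0) :
    v = pointVec (spatial v) := by
  have h := eq_sphereVec hv h0
  rwa [hr, sphereVec_zero] at h

/-- An isotropic vector with components `0` and `1` is an oriented plane. -/
theorem eq_planeVec {v : V} {x : E3} (h0 : compZero v = 0) (hr : compR v = 1)
    (hx : lieForm v (pointVec x) = 0) : v = planeVec (spatial v) (inner ℝ (spatial v) x) := by
  simp only [compZero, compR] at h0 hr
  have h4 : v 4 = v 3 := by linarith
  simp [lieForm_apply, pointVec, embed, eZero, eInf, h4] at hx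
  ext i; fin_cases i <;>
    simp [planeVec, embed, eInf, eR, inner_E3, h4, hr] <;> linarith

theorem norm_spatial_eq_one {v : V} (hv : lieForm v v = 0) (h0 : compZero v = 0)
    (hr : compR v = 1) : ‖spatial v‖ = 1 := by
  simp only [compZero, compR] at h0 hr
  have h4 : v 4 = v 3 := by linarith
  rw [lieForm_apply, h4, hr] at hv
  have : ‖spatial v‖ ^ 2 = 1 := by
    rw [norm_sq_E3]; simp; linarith
  nlinarith [norm_nonneg (spatial v)]

/-- An isotropic vector without `e₀`- and `e_r`-components is a multiple of `e∞`. -/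
theorem eq_smul_eInf {v : V} (hv : lieForm v v = 0) (h0 : compZero v = 0) (hr : compR v = 0) :
    v = (2 * v 3) • eInf := by
  simp only [compZero, compR] at h0 hr
  have h4 : v 4 = v 3 := by linarith
  rw [lieForm_apply, h4, hr] at hv
  have e0 : v 0 = 0 := by nlinarith [sq_nonneg (v 0), sq_nonneg (v 1), sq_nonneg (v 2)]
  have e1 : v 1 = 0 := by nlinarith [sq_nonneg (v 0), sq_nonneg (v 1), sq_nonneg (v 2)]
  have e2 : v 2 = 0 := by nlinarith [sq_nonneg (v 0), sq_nonneg (v 1), sq_nonneg (v 2)]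
  ext i; fin_cases i <;> simp [eInf, e0, e1, e2, h4, hr] <;> ring

/-! ### Contact elements spanned by two vectors -/

/-- The vectors `u` and `v` span a contact element. -/
structure SpansContact (u v : V) : Prop where
  indep : LinearIndependent ℝ ![u, v]
  left : lieForm u u = 0
  right : lieForm v v = 0
  ortho : lieForm u v = 0

theorem SpansContact.comb_eq_zero {u v : V} (h : SpansContact u v) {a b : ℝ}
    (hab : a • u + b • v = 0) : a = 0 ∧ b = 0 :=
  LinearIndependent.pair_iff.1 h.indep a b hab

theorem SpansContact.lieForm_comb {u v : V} (h : SpansContact u v) (a b c d : ℝ) :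
    lieForm (a • u + b • v) (c • u + d • v) = 0 := by
  simp [h.left, h.right, h.ortho, lieForm_comm v u]

theorem SpansContact.isContactElement {u v : V} (h : SpansContact u v) :
    IsContactElement (Submodule.span ℝ {u, v}) := by
  constructor
  · have := finrank_span_eq_card h.indep
    rwa [Matrix.range_cons, Matrix.range_cons, Matrix.range_empty, Set.union_empty,
      Set.singleton_union, Fintype.card_fin] at this
  · intro w hw
    obtain ⟨a, b, rfl⟩ := Submodule.mem_span_pair.1 hw
    exact h.lieForm_comb a b a b

/-- No contact element contains two point spheres. -/
theorem SpansContact.compR_ne {u v : V} (h : SpansContact u v) : ¬(compR u = 0 ∧ compR v = 0) := by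
  rintro ⟨hu, hv⟩
  -- The form is positive definite on the first four coordinates.
  have key : ∀ w : V, lieForm w w = 0 → w 4 = 0 → w 5 = 0 → w = 0 := by
    intro w hw h4 h5
    rw [lieForm_apply, h4, h5] at hw
    have e0 : w 0 = 0 := by
      nlinarith [sq_nonneg (w 0), sq_nonneg (w 1), sq_nonneg (w 2), sq_nonneg (w 3)]
    have e1 : w 1 = 0 := by
      nlinarith [sq_nonneg (w 0), sq_nonneg (w 1), sq_nonneg (w 2), sq_nonneg (w 3)]
    have e2 : w 2 = 0 := by
      nlinarith [sq_nonneg (w 0), sq_nonneg (w 1), sq_nonneg (w 2), sq_nonneg (w 3)]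
    have e3 : w 3 = 0 := by
      nlinarith [sq_nonneg (w 0), sq_nonneg (w 1), sq_nonneg (w 2), sq_nonneg (w 3)]
    ext i; fin_cases i <;> simp [*]
  simp only [compR] at hu hv
  -- This combination is chosen to cancel the `e₅`-coordinate; its vanishing gives `v 4 = 0`, and
  -- then `v` itself is zero.
  have h1 := h.comb_eq_zero (key (v 4 • u + (-u 4) • v) (h.lieForm_comb _ _ _ _)
    (by simp; ring) (by simp [hu, hv]))
  have h2 := key v h.right h1.1 hv
  have := h.comb_eq_zero (a := 0) (b := 1) (by simp [h2])
  exact one_ne_zero this.2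

/-- The point sphere in the contact element spanned by two vectors. -/
def pointComb (u v : V) : V := compR v • u - compR u • v

theorem compR_pointComb (u v : V) : compR (pointComb u v) = 0 := by
  simp only [pointComb, compR_sub, compR_smul]; ring

theorem compZero_pointComb (u v : V) :
    compZero (pointComb u v) = compR v * compZero u - compR u * compZero v := by
  simp only [pointComb, compZero_sub, compZero_smul]

theorem pointComb_eq (u v : V) : pointComb u v = compR v • u + (-compR u) • v := by
  simp [pointComb, sub_eq_add_neg]

theorem SpansContact.pointComb_ne_zero {u v : V} (h : SpansContact u v) : pointComb u v ≠ 0 := by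
  intro h0
  rw [pointComb_eq] at h0
  have := h.comb_eq_zero h0
  exact h.compR_ne ⟨by linarith, this.1⟩

theorem SpansContact.lieForm_pointComb {u v : V} (h : SpansContact u v) :
    lieForm (pointComb u v) (pointComb u v) = 0 := by
  rw [pointComb_eq]; exact h.lieForm_comb _ _ _ _

theorem pointComb_mem (u v : V) : pointComb u v ∈ Submodule.span ℝ {u, v} := by
  rw [pointComb_eq]; exact Submodule.mem_span_pair.2 ⟨_, _, rfl⟩

/-- A vector of a contact element without `e_r`-component is a multiple of its point sphere. -/
theorem SpansContact.exists_smul_pointComb {u v w : V} (h : SpansContact u v)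
    (hw : w ∈ Submodule.span ℝ {u, v}) (hr : compR w = 0) : ∃ c : ℝ, w = c • pointComb u v := by
  obtain ⟨a, b, rfl⟩ := Submodule.mem_span_pair.1 hw
  rw [compR_add, compR_smul, compR_smul] at hr
  -- The condition is one linear equation for `a` and `b`; it is solved through whichever
  -- `e_r`-component is nonzero.
  by_cases hv : compR v = 0
  · have hu : compR u ≠ 0 := fun hu => h.compR_ne ⟨hu, hv⟩
    have ha : a = 0 := by simpa [hv, hu] using hr
    refine ⟨-b / compR u, ?_⟩
    rw [pointComb_eq, hv, ha, smul_add, smul_smul, smul_smul]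
    congr 2
    · simp
    · field_simp
  · refine ⟨a / compR v, ?_⟩
    rw [pointComb_eq, smul_add, smul_smul, smul_smul]
    congr 2
    · field_simp
    · field_simp; linarith

theorem SpansContact.exists_eInf {u v : V} (h : SpansContact u v)
    (h0 : compZero (pointComb u v) = 0) : ∃ c : ℝ, c ≠ 0 ∧ pointComb u v = c • eInf := by
  have e := eq_smul_eInf h.lieForm_pointComb h0 (compR_pointComb u v)
  refine ⟨_, fun hc => ?_, e⟩
  rw [hc, zero_smul] at e
  exact h.pointComb_ne_zero e

/-- Contact elements that contain `∞` consist of planes. -/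
theorem SpansContact.compZero_pointComb_ne {u v : V} (h : SpansContact u v)
    (hu : compZero u ≠ 0) : compZero (pointComb u v) ≠ 0 := by
  intro h0
  obtain ⟨c, hc, e⟩ := h.exists_eInf h0
  -- The product of `u` with the point sphere is zero, but for `c • eInf` it is `-c / 2` times the
  -- `e₀`-component of `u`.
  have h1 := h.lieForm_comb (compR v) (-compR u) 1 0
  rw [← pointComb_eq, e] at h1
  simp only [one_smul, zero_smul, add_zero, map_smul, LinearMap.smul_apply, smul_eq_mul,
    lieForm_eInf] at h1
  rcases mul_eq_zero.1 h1 with h1 | h1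
  · exact hc h1
  · apply hu; linarith

/-- The oriented plane in the contact element spanned by two vectors. -/
noncomputable def planeComb (u v : V) : V :=
  (compZero (pointComb u v))⁻¹ • (compZero u • v - compZero v • u)

/-- The normalized point sphere in the contact element spanned by two vectors. -/
noncomputable def unitPointComb (u v : V) : V :=
  (compZero (pointComb u v))⁻¹ • pointComb u v

theorem compZero_planeComb (u v : V) : compZero (planeComb u v) = 0 := by
  simp only [planeComb, compZero_sub, compZero_smul]; ring

theorem compR_planeComb {u v : V} (h0 : compZero (pointComb u v) ≠ 0) :
    compR (planeComb u v) = 1 := by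
  simp only [planeComb, compR_sub, compR_smul]
  rw [inv_mul_eq_one₀ h0, compZero_pointComb]; ring

theorem planeComb_eq (u v : V) : planeComb u v =
    (-((compZero (pointComb u v))⁻¹ * compZero v)) • u +
      ((compZero (pointComb u v))⁻¹ * compZero u) • v := by
  simp only [planeComb]; module

theorem unitPointComb_eq (u v : V) : unitPointComb u v =
    ((compZero (pointComb u v))⁻¹ * compR v) • u +
      (-((compZero (pointComb u v))⁻¹ * compR u)) • v := by
  simp only [unitPointComb, pointComb]; module

theorem SpansContact.unitPointComb_eq_pointVec {u v : V} (h : SpansContact u v)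
    (h0 : compZero (pointComb u v) ≠ 0) :
    unitPointComb u v = pointVec (spatial (unitPointComb u v)) := by
  apply eq_pointVec
  · rw [unitPointComb_eq]; exact h.lieForm_comb _ _ _ _
  · rw [unitPointComb, compZero_smul, inv_mul_cancel₀ h0]
  · rw [unitPointComb, compR_smul, compR_pointComb, mul_zero]

theorem SpansContact.planeComb_eq_planeVec {u v : V} (h : SpansContact u v)
    (h0 : compZero (pointComb u v) ≠ 0) :
    planeComb u v = planeVec (spatial (planeComb u v))
      (inner ℝ (spatial (planeComb u v)) (spatial (unitPointComb u v))) := by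
  apply eq_planeVec (compZero_planeComb u v) (compR_planeComb h0)
  rw [← h.unitPointComb_eq_pointVec h0, planeComb_eq, unitPointComb_eq]
  exact h.lieForm_comb _ _ _ _

theorem SpansContact.norm_normal {u v : V} (h : SpansContact u v)
    (h0 : compZero (pointComb u v) ≠ 0) : ‖spatial (planeComb u v)‖ = 1 := by
  refine norm_spatial_eq_one ?_ (compZero_planeComb u v) (compR_planeComb h0)
  rw [planeComb_eq]; exact h.lieForm_comb _ _ _ _

/-- A vector is recovered from the point and the plane of its contact element. -/
theorem left_eq_comb {u v : V} (h0 : compZero (pointComb u v) ≠ 0) :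
    compZero u • unitPointComb u v + compR u • planeComb u v = u := by
  rw [unitPointComb_eq, planeComb_eq]
  match_scalars
  · have := compZero_pointComb u v
    field_simp; linarith
  · ring

theorem right_eq_comb {u v : V} (h0 : compZero (pointComb u v) ≠ 0) :
    compZero v • unitPointComb u v + compR v • planeComb u v = v := by
  rw [unitPointComb_eq, planeComb_eq]
  match_scalars
  · ring
  · have := compZero_pointComb u v
    field_simp; linarith

theorem SpansContact.span_eq_contactElementAt {u v : V} (h : SpansContact u v)
    (h0 : compZero (pointComb u v) ≠ 0) : Submodule.span ℝ {u, v} =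
      contactElementAt (spatial (unitPointComb u v)) (spatial (planeComb u v)) := by
  rw [contactElementAt, ← h.planeComb_eq_planeVec h0, ← h.unitPointComb_eq_pointVec h0]
  apply le_antisymm <;> rw [Submodule.span_le, Set.insert_subset_iff, Set.singleton_subset_iff]
  · exact ⟨Submodule.mem_span_pair.2 ⟨_, _, left_eq_comb h0⟩,
      Submodule.mem_span_pair.2 ⟨_, _, right_eq_comb h0⟩⟩
  · exact ⟨Submodule.mem_span_pair.2 ⟨_, _, (unitPointComb_eq u v).symm⟩,
      Submodule.mem_span_pair.2 ⟨_, _, (planeComb_eq u v).symm⟩⟩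

theorem pointComb_smul (a b : ℝ) (u v : V) :
    pointComb (a • u) (b • v) = (a * b) • pointComb u v := by
  simp only [pointComb, compR_smul]; module

theorem unitPointComb_smul {a b : ℝ} (ha : a ≠ 0) (hb : b ≠ 0) (u v : V) :
    unitPointComb (a • u) (b • v) = unitPointComb u v := by
  simp only [unitPointComb, pointComb_smul, compZero_smul, smul_smul]
  congr 1
  field_simp

theorem planeComb_smul {a b : ℝ} (ha : a ≠ 0) (hb : b ≠ 0) (u v : V) :
    planeComb (a • u) (b • v) = planeComb u v := by
  simp only [planeComb, pointComb_smul, compZero_smul]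
  match_scalars <;> field_simp

/-! ### Planes of signature `(+ + -)` -/

theorem HasSignaturePPM.exists_coords {P : Submodule ℝ V} (hP : HasSignaturePPM P) :
    ∃ b : Fin 3 → V, (∀ v ∈ P, ∃ x : Fin 3 → ℝ, v = ∑ i, x i • b i) ∧
      (∀ i, b i ∈ P) ∧
      ∀ x y : Fin 3 → ℝ, lieForm (∑ i, x i • b i) (∑ i, y i • b i) =
        x 0 * y 0 + x 1 * y 1 - x 2 * y 2 := by
  obtain ⟨b, hb⟩ := hP
  refine ⟨fun i => b i, fun v hv => ⟨b.repr ⟨v, hv⟩, ?_⟩, fun i => (b i).2, fun x y => ?_⟩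
  · have := congrArg Subtype.val (b.sum_repr ⟨v, hv⟩)
    simpa only [AddSubmonoidClass.coe_finsetSum, Submodule.coe_smul] using this.symm
  · simp [Fin.sum_univ_succ, hb]
    ring

/-- Nondegeneracy of the plane, needed to see that polar planes meet only in zero. -/
theorem HasSignaturePPM.eq_zero {P : Submodule ℝ V} (hP : HasSignaturePPM P) {v : V} (hv : v ∈ P)
    (h : ∀ w ∈ P, lieForm w v = 0) : v = 0 := by
  obtain ⟨b, hb, hmem, hform⟩ := hP.exists_coords
  obtain ⟨x, rfl⟩ := hb v hv
  have key (j : Fin 3) := h (∑ i, (Pi.single j 1 : Fin 3 → ℝ) i • b i)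
    (P.sum_mem fun i _ => P.smul_mem _ (hmem i))
  simp only [hform] at key
  have h0 := key 0
  have h1 := key 1
  have h2 := key 2
  simp at h0 h1 h2
  simp [Fin.sum_univ_succ, h0, h1, h2]

/-- A plane of signature `(+ + -)` contains no contact element. -/
theorem HasSignaturePPM.exists_smul {P : Submodule ℝ V} (hP : HasSignaturePPM P) {u v : V}
    (hu : u ∈ P) (hv : v ∈ P) (hu0 : u ≠ 0) (huu : lieForm u u = 0)
    (hvv : lieForm v v = 0) (huv : lieForm u v = 0) : ∃ c : ℝ, v = c • u := by
  obtain ⟨b, hb, hmem, hform⟩ := hP.exists_coords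
  obtain ⟨x, rfl⟩ := hb u hu
  obtain ⟨y, rfl⟩ := hb v hv
  rw [hform] at huu hvv huv
  have hx2 : x 2 ≠ 0 := by
    intro h2
    rw [h2] at huu
    have e0 : x 0 = 0 := by nlinarith [sq_nonneg (x 0), sq_nonneg (x 1)]
    have e1 : x 1 = 0 := by nlinarith [sq_nonneg (x 0), sq_nonneg (x 1)]
    exact hu0 (by simp [Fin.sum_univ_succ, e0, e1, h2])
  -- The combination `x₂ v - y₂ u` is isotropic and has no negative coordinate, so its positive
  -- coordinates vanish too.
  have hsum : (x 2 * y 0 - y 2 * x 0) ^ 2 + (x 2 * y 1 - y 2 * x 1) ^ 2 = 0 := by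
    linear_combination (x 2) ^ 2 * hvv + (y 2) ^ 2 * huu - 2 * x 2 * y 2 * huv
  have h0 : x 2 * y 0 - y 2 * x 0 = 0 := by
    nlinarith [sq_nonneg (x 2 * y 0 - y 2 * x 0), sq_nonneg (x 2 * y 1 - y 2 * x 1)]
  have h1 : x 2 * y 1 - y 2 * x 1 = 0 := by
    nlinarith [sq_nonneg (x 2 * y 0 - y 2 * x 0), sq_nonneg (x 2 * y 1 - y 2 * x 1)]
  refine ⟨y 2 / x 2, ?_⟩
  rw [Finset.smul_sum]
  refine Finset.sum_congr rfl fun i _ => ?_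
  rw [smul_smul]
  congr 1
  field_simp
  fin_cases i
  · simp; linarith
  · simp; linarith
  · simp

theorem HasSignaturePPM.finrank {P : Submodule ℝ V} (hP : HasSignaturePPM P) :
    Module.finrank ℝ P = 3 := by
  obtain ⟨b, -⟩ := hP
  simpa using Module.finrank_eq_card_basis b

/-! ### Conics through three points -/

/-- The vectors `S` represent three different points of the conic in the plane `P`. -/
structure IsConicTriple (P : Submodule ℝ V) (S : Fin 3 → V) : Prop where
  mem : ∀ j, S j ∈ P
  iso : ∀ j, lieForm (S j) (S j) = 0
  weight_ne : ∀ j, weight S j ≠ 0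
  span : ∀ v ∈ P, ∃ c : Fin 3 → ℝ, v = ∑ j, c j • S j

theorem lieForm_sum {S : Fin 3 → V} (iso : ∀ j, lieForm (S j) (S j) = 0) (x y : Fin 3 → ℝ) :
    lieForm (∑ j, x j • S j) (∑ j, y j • S j) =
      (x 0 * y 1 + x 1 * y 0) * weight S 2 + (x 0 * y 2 + x 2 * y 0) * weight S 1 +
        (x 1 * y 2 + x 2 * y 1) * weight S 0 := by
  simp [Fin.sum_univ_succ, iso, weight, lieForm_comm (S 1) (S 0), lieForm_comm (S 2) (S 0),
    lieForm_comm (S 2) (S 1)]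
  have h0 := iso 0
  have h1 := iso 1
  have h2 := iso 2
  ring

/-- The Gram matrix has zero diagonal, hence determinant twice the product of the weights. Pairing a
relation with each `S j` gives its three rows, which are then eliminated by hand. -/
theorem linearIndependent_of_weight_ne {S : Fin 3 → V} (iso : ∀ j, lieForm (S j) (S j) = 0)
    (hw : ∀ j, weight S j ≠ 0) : LinearIndependent ℝ S := by
  rw [Fintype.linearIndependent_iff]
  intro g hg
  have key (j : Fin 3) := lieForm_sum iso (Pi.single j 1) g
  simp only [hg, map_zero] at key
  have h0 := key 0
  have h1 := key 1
  have h2 := key 2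
  have w0 := hw 0
  have w1 := hw 1
  have w2 := hw 2
  simp at h0 h1 h2
  have e0 : g 0 * (2 * weight S 1 * weight S 2) = 0 := by
    linear_combination weight S 0 * h0 - weight S 1 * h1 - weight S 2 * h2
  have e1 : g 1 * (2 * weight S 0 * weight S 2) = 0 := by
    linear_combination weight S 1 * h1 - weight S 0 * h0 - weight S 2 * h2
  have e2 : g 2 * (2 * weight S 0 * weight S 1) = 0 := by
    linear_combination weight S 2 * h2 - weight S 0 * h0 - weight S 1 * h1
  intro i
  fin_cases i
  · simpa [w1, w2] using e0
  · simpa [w0, w2] using e1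
  · simpa [w0, w1] using e2

/-- Orthogonal isotropic vectors of the plane are proportional, so different points have nonzero
weights. Independence and the dimension three then give the spanning property. -/
theorem HasSignaturePPM.isConicTriple {P : Submodule ℝ V} (hP : HasSignaturePPM P)
    {S : Fin 3 → V} (mem : ∀ j, S j ∈ P) (iso : ∀ j, lieForm (S j) (S j) = 0)
    (hS : ∀ j, S j ≠ 0)
    (hne : Function.Injective fun j => Projectivization.mk ℝ (S j) (hS j)) :
    IsConicTriple P S := by
  have hform : ∀ i j, i ≠ j → lieForm (S i) (S j) ≠ 0 := by
    intro i j hij h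
    obtain ⟨c, hc⟩ := hP.exists_smul (mem i) (mem j) (hS i) (iso i) (iso j) h
    refine hij (hne ?_)
    exact ((Projectivization.mk_eq_mk_iff' ℝ _ _ (hS j) (hS i)).2 ⟨c, hc.symm⟩).symm
  have hw : ∀ j, weight S j ≠ 0 := by
    intro j
    fin_cases j
    · exact hform 1 2 (by decide)
    · exact hform 0 2 (by decide)
    · exact hform 0 1 (by decide)
  refine ⟨mem, iso, hw, fun v hv => ?_⟩
  have hle : Submodule.span ℝ (Set.range S) ≤ P := by
    rw [Submodule.span_le]; rintro _ ⟨j, rfl⟩; exact mem j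
  have heq : Submodule.span ℝ (Set.range S) = P := by
    refine Submodule.eq_of_le_of_finrank_eq hle ?_
    rw [hP.finrank, finrank_span_eq_card (linearIndependent_of_weight_ne iso hw)]
    simp
  rw [← heq] at hv
  obtain ⟨c, hc⟩ := (Submodule.mem_span_range_iff_exists_fun ℝ).1 hv
  exact ⟨c, hc.symm⟩

namespace IsConicTriple

variable {P : Submodule ℝ V} {S : Fin 3 → V}

theorem coeff_eq (h : IsConicTriple P S) {x y : Fin 3 → ℝ}
    (hxy : ∑ j, (weight S j * x j) • S j = ∑ j, (weight S j * y j) • S j) : x = y := by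
  have := Fintype.linearIndependent_iff.1 (linearIndependent_of_weight_ne h.iso h.weight_ne)
    (fun j => weight S j * x j - weight S j * y j)
    (by simp only [sub_smul, Finset.sum_sub_distrib, hxy, sub_self])
  ext j
  have hj := this j
  rw [← mul_sub] at hj
  have := (mul_eq_zero.1 hj).resolve_left (h.weight_ne j)
  linarith

/-- The reason for the weights: every mixed term acquires the same factor, so all conics reduce to
one model. -/
theorem lieForm_weighted (h : IsConicTriple P S) (x y : Fin 3 → ℝ) :
    lieForm (∑ j, (weight S j * x j) • S j) (∑ j, (weight S j * y j) • S j) =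
      weight S 0 * weight S 1 * weight S 2 *
        (x 0 * y 1 + x 1 * y 0 + x 0 * y 2 + x 2 * y 0 + x 1 * y 2 + x 2 * y 1) := by
  rw [lieForm_sum h.iso]; ring

theorem exists_weighted (h : IsConicTriple P S) {v : V} (hv : v ∈ P) :
    ∃ x : Fin 3 → ℝ, v = ∑ j, (weight S j * x j) • S j := by
  obtain ⟨c, rfl⟩ := h.span v hv
  refine ⟨fun j => c j / weight S j, Finset.sum_congr rfl fun j _ => ?_⟩
  rw [mul_div_cancel₀ _ (h.weight_ne j)]

theorem weighted_smul (c : ℝ) (x : Fin 3 → ℝ) :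
    c • ∑ j, (weight S j * x j) • S j = ∑ j, (weight S j * (c • x) j) • S j := by
  rw [Finset.smul_sum]
  refine Finset.sum_congr rfl fun j _ => ?_
  rw [smul_smul, Pi.smul_apply, smul_eq_mul]
  congr 1
  ring

end IsConicTriple

/-! ### The model conic `x₀x₁ + x₀x₂ + x₁x₂ = 0` -/

theorem quadCoeff_coe (t : ℝ) :
    quadCoeff (t : OnePoint ℝ) = ![2 * t ^ 2 - 3 * t + 1, t - t ^ 2, 2 * t ^ 2 - t] := rfl

theorem quadCoeff_infty : quadCoeff OnePoint.infty = ![2, -1, 2] := rfl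

/-- The linear form `x₀ + 4x₁ + x₂` is `1` at finite parameters and `0` at `∞`, so it separates
these cases and fixes the scale; then `2x₁ + x₂` has the value `t`. -/
theorem quadCoeff_injective {t t' : OnePoint ℝ} {c : ℝ} (h : c • quadCoeff t' = quadCoeff t) :
    t' = t := by
  have key : ∀ x y : ℝ, c * (2 * x ^ 2 - 3 * x + 1) = 2 * y ^ 2 - 3 * y + 1 →
      c * (x - x ^ 2) = y - y ^ 2 → c * (2 * x ^ 2 - x) = 2 * y ^ 2 - y → x = y := by
    intro x y h0 h1 h2
    have hc : c = 1 := by linear_combination h0 + 4 * h1 + h2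
    subst hc
    linarith
  induction t using OnePoint.rec <;> induction t' using OnePoint.rec
  · rfl
  · rename_i x
    have h0 := congrFun h 0
    have h1 := congrFun h 1
    have h2 := congrFun h 2
    simp [quadCoeff_coe, quadCoeff_infty] at h0 h1 h2
    have hc : c = 0 := by linear_combination h0 + 4 * h1 + h2
    simp [hc] at h0
  · rename_i x
    have h0 := congrFun h 0
    have h1 := congrFun h 1
    have h2 := congrFun h 2
    simp [quadCoeff_coe, quadCoeff_infty] at h0 h1 h2
    linarith
  · rename_i x y
    have h0 := congrFun h 0
    have h1 := congrFun h 1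
    have h2 := congrFun h 2
    simp [quadCoeff_coe] at h0 h1 h2
    rw [key y x h0 h1 h2]

theorem quadCoeff_conic (t : OnePoint ℝ) : quadCoeff t 0 * quadCoeff t 1 +
    quadCoeff t 0 * quadCoeff t 2 + quadCoeff t 1 * quadCoeff t 2 = 0 := by
  induction t using OnePoint.rec
  · simp [quadCoeff_infty]; norm_num
  · simp [quadCoeff_coe]; ring

theorem quadCoeff_ne_zero (t : OnePoint ℝ) : quadCoeff t ≠ 0 := by
  intro h
  have h0 := congrFun h 0
  have h1 := congrFun h 1
  have h2 := congrFun h 2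
  induction t using OnePoint.rec
  · simp [quadCoeff_infty] at h0
  · simp [quadCoeff_coe] at h0 h1 h2
    linarith

theorem quadCoeff_surjective {x : Fin 3 → ℝ}
    (h : x 0 * x 1 + x 0 * x 2 + x 1 * x 2 = 0) :
    ∃ (t : OnePoint ℝ) (c : ℝ), x = c • quadCoeff t := by
  -- This line is the tangent of the conic at `t = ∞`, so it meets the conic only there. Elsewhere
  -- the parameter is the quotient of `2x₁ + x₂` by this linear form.
  by_cases hC : x 0 + 4 * x 1 + x 2 = 0
  · have hB : (2 * x 1 + x 2) ^ 2 = 0 := by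
      linear_combination (x 1 + x 2) * hC - h
    have hB := pow_eq_zero_iff (two_ne_zero) |>.1 hB
    refine ⟨OnePoint.infty, x 1 + x 2, ?_⟩
    ext i
    fin_cases i <;> simp [quadCoeff_infty] <;> linarith
  · refine ⟨(((2 * x 1 + x 2) / (x 0 + 4 * x 1 + x 2) : ℝ) : OnePoint ℝ),
      x 0 + 4 * x 1 + x 2, ?_⟩
    ext i
    fin_cases i <;> simp [quadCoeff_coe] <;> field_simp
    · linear_combination 2 * h
    · rw [eq_div_iff (by intro h; apply hC; linarith)]
      linear_combination -h
    · linear_combination 2 * h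

/-! ### Components and special values of the parametrization -/

theorem compR_conicVec (S : Fin 3 → V) (t : OnePoint ℝ) :
    compR (conicVec S t) = radiusFun S t := by
  simp only [conicVec, radiusFun, Fin.sum_univ_three, compR_add, compR_smul]; ring

theorem compZero_conicVec (S : Fin 3 → V) (t : OnePoint ℝ) :
    compZero (conicVec S t) = scaleFun S t := by
  simp only [conicVec, scaleFun, Fin.sum_univ_three, compZero_add, compZero_smul]; ring

theorem conicVec_zero (S : Fin 3 → V) :
    conicVec S ((0 : ℝ) : OnePoint ℝ) = weight S 0 • S 0 := by
  simp [conicVec, Fin.sum_univ_three, quadCoeff_coe]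

theorem conicVec_half (S : Fin 3 → V) :
    conicVec S ((1 / 2 : ℝ) : OnePoint ℝ) = (weight S 1 / 4) • S 1 := by
  simp [conicVec, Fin.sum_univ_three, quadCoeff_coe]; norm_num [div_eq_mul_inv]

theorem conicVec_one (S : Fin 3 → V) :
    conicVec S ((1 : ℝ) : OnePoint ℝ) = weight S 2 • S 2 := by
  simp [conicVec, Fin.sum_univ_three, quadCoeff_coe]; norm_num

/-- The coefficients of `quadCoeff` in a chart, without denominators. -/
def polyCoeff : Fin 2 → ℝ → Fin 3 → ℝ
  | 0, u => ![2 * u ^ 2 - 3 * u + 1, u - u ^ 2, 2 * u ^ 2 - u]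
  | 1, u => ![2 - 3 * u + u ^ 2, u - 1, 2 - u]

/-- The derivative of `polyCoeff`. -/
def polyCoeffDeriv : Fin 2 → ℝ → Fin 3 → ℝ
  | 0, u => ![4 * u - 3, 1 - 2 * u, 4 * u - 1]
  | 1, u => ![2 * u - 3, 1, -1]

/-- The quadratic parametrization in a chart, without denominators. -/
noncomputable def polyVec (S : Fin 3 → V) (k : Fin 2) (u : ℝ) : V :=
  ∑ j, (weight S j * polyCoeff k u j) • S j

/-- The derivative of `polyVec`. -/
noncomputable def polyVecDeriv (S : Fin 3 → V) (k : Fin 2) (u : ℝ) : V :=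
  ∑ j, (weight S j * polyCoeffDeriv k u j) • S j

/-- In the chart at `∞` the factor is `u⁻²`, but `1` at `u = 0`. Its discontinuity does no harm,
since only projective data are compared. -/
theorem exists_quadCoeff_chart (k : Fin 2) (u : ℝ) :
    ∃ c : ℝ, c ≠ 0 ∧ quadCoeff (chart k u) = c • polyCoeff k u := by
  fin_cases k
  · exact ⟨1, one_ne_zero, by rw [one_smul]; rfl⟩
  · by_cases hu : u = 0
    · refine ⟨1, one_ne_zero, ?_⟩
      simp [chart, hu, polyCoeff, quadCoeff_infty]
    · refine ⟨(u ^ 2)⁻¹, by positivity, ?_⟩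
      simp only [chart, hu, polyCoeff, if_false, quadCoeff_coe]
      ext i
      fin_cases i <;> simp <;> field_simp

theorem exists_conicVec_chart (S : Fin 3 → V) (k : Fin 2) (u : ℝ) :
    ∃ c : ℝ, c ≠ 0 ∧ conicVec S (chart k u) = c • polyVec S k u := by
  obtain ⟨c, hc, h⟩ := exists_quadCoeff_chart k u
  refine ⟨c, hc, ?_⟩
  rw [polyVec, IsConicTriple.weighted_smul, ← h, conicVec]

theorem hasDerivAt_polyCoeff (k : Fin 2) (u : ℝ) (j : Fin 3) :
    HasDerivAt (fun x => polyCoeff k x j) (polyCoeffDeriv k u j) u := by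
  have h1 := hasDerivAt_id' u
  have h2 : HasDerivAt (fun x : ℝ => x ^ 2) (2 * u) u := by simpa using hasDerivAt_pow 2 u
  fin_cases k <;> fin_cases j
  · change HasDerivAt (fun x : ℝ => 2 * x ^ 2 - 3 * x + 1) (4 * u - 3) u
    exact (((h2.const_mul 2).sub (h1.const_mul 3)).add_const 1).congr_deriv (by ring)
  · exact h1.sub h2
  · change HasDerivAt (fun x : ℝ => 2 * x ^ 2 - x) (4 * u - 1) u
    exact ((h2.const_mul 2).sub h1).congr_deriv (by ring)
  · change HasDerivAt (fun x : ℝ => 2 - 3 * x + x ^ 2) (2 * u - 3) u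
    exact (((h1.const_mul 3).const_sub 2).add h2).congr_deriv (by ring)
  · exact h1.sub_const 1
  · exact h1.const_sub 2

theorem hasDerivAt_polyVec (S : Fin 3 → V) (k : Fin 2) (u : ℝ) :
    HasDerivAt (polyVec S k) (polyVecDeriv S k u) u := by
  unfold polyVec polyVecDeriv
  exact HasDerivAt.fun_sum fun j _ =>
    ((hasDerivAt_polyCoeff k u j).const_mul (weight S j)).smul_const (S j)

theorem contDiff_polyVec (S : Fin 3 → V) (k : Fin 2) {n : WithTop ℕ∞} :
    ContDiff ℝ n (polyVec S k) := by
  unfold polyVec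
  have h (j : Fin 3) : ContDiff ℝ n fun u => polyCoeff k u j := by
    fin_cases k <;> fin_cases j <;> simp [polyCoeff] <;> fun_prop
  fun_prop

namespace IsConicTriple

variable {P : Submodule ℝ V} {S : Fin 3 → V}

theorem conicVec_mem (h : IsConicTriple P S) (t : OnePoint ℝ) : conicVec S t ∈ P :=
  P.sum_mem fun j _ => P.smul_mem _ (h.mem j)

theorem polyVecDeriv_mem (h : IsConicTriple P S) (k : Fin 2) (u : ℝ) : polyVecDeriv S k u ∈ P :=
  P.sum_mem fun j _ => P.smul_mem _ (h.mem j)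

theorem polyVec_mem (h : IsConicTriple P S) (k : Fin 2) (u : ℝ) : polyVec S k u ∈ P :=
  P.sum_mem fun j _ => P.smul_mem _ (h.mem j)

theorem lieForm_conicVec (h : IsConicTriple P S) (t : OnePoint ℝ) :
    lieForm (conicVec S t) (conicVec S t) = 0 := by
  rw [conicVec, h.lieForm_weighted]
  linear_combination (2 * (weight S 0 * weight S 1 * weight S 2)) * quadCoeff_conic t

theorem conicVec_ne_zero (h : IsConicTriple P S) (t : OnePoint ℝ) : conicVec S t ≠ 0 := by
  intro h0
  apply quadCoeff_ne_zero t
  apply h.coeff_eq (y := 0)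
  rw [← conicVec, h0]
  simp

theorem conicVec_injective (h : IsConicTriple P S) {t t' : OnePoint ℝ} {c : ℝ}
    (hc : c • conicVec S t' = conicVec S t) : t' = t := by
  rw [conicVec, weighted_smul] at hc
  exact quadCoeff_injective (h.coeff_eq hc)

theorem conicVec_surjective (h : IsConicTriple P S) {v : V} (hv : v ∈ P)
    (hvv : lieForm v v = 0) : ∃ (t : OnePoint ℝ) (c : ℝ), v = c • conicVec S t := by
  obtain ⟨x, rfl⟩ := h.exists_weighted hv
  rw [h.lieForm_weighted, mul_eq_zero, or_iff_right (mul_ne_zero (mul_ne_zero (h.weight_ne 0)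
    (h.weight_ne 1)) (h.weight_ne 2))] at hvv
  obtain ⟨t, c, rfl⟩ := quadCoeff_surjective (x := x) (by linarith)
  exact ⟨t, c, by rw [conicVec, weighted_smul]⟩

theorem polyVec_ne_zero (h : IsConicTriple P S) (k : Fin 2) (u : ℝ) : polyVec S k u ≠ 0 := by
  obtain ⟨c, -, hc⟩ := exists_conicVec_chart S k u
  intro h0
  rw [h0, smul_zero] at hc
  exact h.conicVec_ne_zero _ hc

theorem lieForm_polyVec (h : IsConicTriple P S) (k : Fin 2) (u : ℝ) :
    lieForm (polyVec S k u) (polyVec S k u) = 0 := by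
  rw [polyVec, h.lieForm_weighted]
  fin_cases k <;> simp [polyCoeff] <;> right <;> ring

theorem lieForm_polyVec_deriv (h : IsConicTriple P S) (k : Fin 2) (u : ℝ) :
    lieForm (polyVec S k u) (polyVecDeriv S k u) = 0 := by
  rw [polyVec, polyVecDeriv, h.lieForm_weighted]
  fin_cases k <;> simp [polyCoeff, polyCoeffDeriv] <;> right <;> ring

/-- The square is a nonzero constant, the same in both charts; this is what makes the Legendre map
immersed. -/
theorem lieForm_polyVecDeriv (h : IsConicTriple P S) (k : Fin 2) (u : ℝ) :
    lieForm (polyVecDeriv S k u) (polyVecDeriv S k u) ≠ 0 := by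
  have e : lieForm (polyVecDeriv S k u) (polyVecDeriv S k u) =
      -2 * (weight S 0 * weight S 1 * weight S 2) := by
    rw [polyVecDeriv, h.lieForm_weighted]
    fin_cases k <;> simp [polyCoeffDeriv] <;> ring
  rw [e]
  simp [h.weight_ne]

end IsConicTriple

/-! ### Derivatives of the point and the normal of a contact element -/

theorem hasFDerivAt_comp_fst {f : ℝ → V} {f' : V} {p : ℝ × ℝ} (h : HasDerivAt f f' p.1) :
    HasFDerivAt (fun q : ℝ × ℝ => f q.1)
      ((ContinuousLinearMap.toSpanSingleton ℝ f').comp (ContinuousLinearMap.fst ℝ ℝ ℝ)) p :=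
  h.hasFDerivAt.comp p hasFDerivAt_fst

theorem hasFDerivAt_comp_snd {f : ℝ → V} {f' : V} {p : ℝ × ℝ} (h : HasDerivAt f f' p.2) :
    HasFDerivAt (fun q : ℝ × ℝ => f q.2)
      ((ContinuousLinearMap.toSpanSingleton ℝ f').comp (ContinuousLinearMap.snd ℝ ℝ ℝ)) p :=
  h.hasFDerivAt.comp p hasFDerivAt_snd

theorem d₁_eq {F : Type*} [NormedAddCommGroup F] [NormedSpace ℝ F] {f : ℝ × ℝ → F} {p : ℝ × ℝ}
    {f' : F} (hf : DifferentiableAt ℝ f p) (h : HasDerivAt (fun s => f (s, p.2)) f' p.1) :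
    d₁ f p = f' := by
  have hc : HasDerivAt (fun s : ℝ => (s, p.2)) ((1 : ℝ), (0 : ℝ)) p.1 :=
    (hasDerivAt_id' p.1).prodMk (hasDerivAt_const p.1 p.2)
  exact (HasFDerivAt.comp_hasDerivAt (f := fun s : ℝ => (s, p.2)) p.1 hf.hasFDerivAt hc).unique h

theorem d₂_eq {F : Type*} [NormedAddCommGroup F] [NormedSpace ℝ F] {f : ℝ × ℝ → F} {p : ℝ × ℝ}
    {f' : F} (hf : DifferentiableAt ℝ f p) (h : HasDerivAt (fun s => f (p.1, s)) f' p.2) :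
    d₂ f p = f' := by
  have hc : HasDerivAt (fun s : ℝ => (p.1, s)) ((0 : ℝ), (1 : ℝ)) p.2 :=
    (hasDerivAt_const p.2 p.1).prodMk (hasDerivAt_id' p.2)
  exact (HasFDerivAt.comp_hasDerivAt (f := fun s : ℝ => (p.1, s)) p.2 hf.hasFDerivAt hc).unique h

/-- `spatial` as a continuous linear map. -/
noncomputable def spatialL : V →L[ℝ] E3 :=
  LinearMap.toContinuousLinearMap
    { toFun := spatial
      map_add' := fun u v => by ext i; fin_cases i <;> simp [spatial]
      map_smul' := fun a v => by ext i; fin_cases i <;> simp [spatial] }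

theorem spatialL_apply (v : V) : spatialL v = spatial v := rfl

/-- `compR` as a continuous linear map. -/
noncomputable def compRL : V →L[ℝ] ℝ := ContinuousLinearMap.proj 5

/-- `compZero` as a continuous linear map. -/
noncomputable def compZeroL : V →L[ℝ] ℝ :=
  ContinuousLinearMap.proj (R := ℝ) (φ := fun _ : Fin 6 => ℝ) 4 - ContinuousLinearMap.proj 3

theorem hasDerivAt_compR {f : ℝ → V} {f' : V} {t : ℝ} (h : HasDerivAt f f' t) :
    HasDerivAt (fun s => compR (f s)) (compR f') t :=
  compRL.hasFDerivAt.comp_hasDerivAt t h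

theorem hasDerivAt_compZero {f : ℝ → V} {f' : V} {t : ℝ} (h : HasDerivAt f f' t) :
    HasDerivAt (fun s => compZero (f s)) (compZero f') t :=
  compZeroL.hasFDerivAt.comp_hasDerivAt t h

theorem hasDerivAt_spatial {f : ℝ → V} {f' : V} {t : ℝ} (h : HasDerivAt f f' t) :
    HasDerivAt (fun s => spatial (f s)) (spatial f') t :=
  spatialL.hasFDerivAt.comp_hasDerivAt t h

theorem contDiff_compR {n : WithTop ℕ∞} : ContDiff ℝ n compR := compRL.contDiff
theorem contDiff_compZero {n : WithTop ℕ∞} : ContDiff ℝ n compZero := compZeroL.contDiff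
theorem contDiff_spatial {n : WithTop ℕ∞} : ContDiff ℝ n spatial := spatialL.contDiff

/-! ### Smoothness of the point and the plane -/

section Smooth

variable {E : Type*} [NormedAddCommGroup E] [NormedSpace ℝ E] {f g : E → V} {n : WithTop ℕ∞}

theorem contDiff_pointComb (hf : ContDiff ℝ n f) (hg : ContDiff ℝ n g) :
    ContDiff ℝ n fun q => pointComb (f q) (g q) :=
  ((contDiff_compR.comp hg).smul hf).sub ((contDiff_compR.comp hf).smul hg)

theorem contDiffAt_unitPointComb (hf : ContDiff ℝ n f) (hg : ContDiff ℝ n g) {p : E}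
    (h0 : compZero (pointComb (f p) (g p)) ≠ 0) :
    ContDiffAt ℝ n (fun q => unitPointComb (f q) (g q)) p := by
  have h := contDiff_pointComb hf hg
  exact ((contDiff_compZero.comp h).contDiffAt.inv h0).smul h.contDiffAt

theorem contDiffAt_planeComb (hf : ContDiff ℝ n f) (hg : ContDiff ℝ n g) {p : E}
    (h0 : compZero (pointComb (f p) (g p)) ≠ 0) :
    ContDiffAt ℝ n (fun q => planeComb (f q) (g q)) p := by
  have h := contDiff_pointComb hf hg
  exact ((contDiff_compZero.comp h).contDiffAt.inv h0).smul
    (((contDiff_compZero.comp hf).smul hg).sub ((contDiff_compZero.comp hg).smul hf)).contDiffAt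

end Smooth

/-- The derivative of `unitPointComb` in the direction `u'` of its first argument. -/
noncomputable def unitPointCombDeriv (u u' v : V) : V :=
  (compZero (pointComb u v))⁻¹ •
    (pointComb u' v - compZero (pointComb u' v) • unitPointComb u v)

/-- The derivative of `planeComb` in the direction `u'` of its first argument. -/
noncomputable def planeCombDeriv (u u' v : V) : V :=
  (compZero (pointComb u v))⁻¹ •
    (compZero u' • v - compZero v • u' - compZero (pointComb u' v) • planeComb u v)

theorem hasDerivAt_pointComb {f : ℝ → V} {f' : V} {t : ℝ} (h : HasDerivAt f f' t) (v : V) :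
    HasDerivAt (fun s => pointComb (f s) v) (pointComb f' v) t :=
  (h.const_smul (compR v)).sub ((hasDerivAt_compR h).smul_const v)

theorem hasDerivAt_unitPointComb {f : ℝ → V} {f' : V} {t : ℝ} (h : HasDerivAt f f' t) (v : V)
    (h0 : compZero (pointComb (f t) v) ≠ 0) :
    HasDerivAt (fun s => unitPointComb (f s) v) (unitPointCombDeriv (f t) f' v) t := by
  have hp := hasDerivAt_pointComb h v
  refine (((hasDerivAt_compZero hp).inv h0).smul hp).congr_deriv ?_
  simp only [unitPointCombDeriv, unitPointComb, Pi.inv_apply]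
  match_scalars <;> field_simp

theorem hasDerivAt_planeComb {f : ℝ → V} {f' : V} {t : ℝ} (h : HasDerivAt f f' t) (v : V)
    (h0 : compZero (pointComb (f t) v) ≠ 0) :
    HasDerivAt (fun s => planeComb (f s) v) (planeCombDeriv (f t) f' v) t := by
  have hp := hasDerivAt_pointComb h v
  refine (((hasDerivAt_compZero hp).inv h0).smul
    (((hasDerivAt_compZero h).smul_const v).sub (h.const_smul (compZero v)))).congr_deriv ?_
  simp only [planeCombDeriv, planeComb, Pi.inv_apply, Pi.sub_apply, Pi.smul_apply]
  match_scalars <;> field_simp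
  ring

theorem pointComb_swap (u v : V) : pointComb v u = -pointComb u v := by
  simp [pointComb]

theorem compZero_neg (u : V) : compZero (-u) = -compZero u := by
  simp [compZero]; ring

theorem unitPointComb_swap (u v : V) : unitPointComb v u = unitPointComb u v := by
  rw [unitPointComb, unitPointComb, pointComb_swap, compZero_neg]; simp

theorem planeComb_swap (u v : V) : planeComb v u = planeComb u v := by
  rw [planeComb, planeComb, pointComb_swap, compZero_neg]; module

theorem SpansContact.symm {u v : V} (h : SpansContact u v) : SpansContact v u where
  indep := by
    rw [LinearIndependent.pair_iff]
    intro a b hab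
    exact (h.comb_eq_zero (a := b) (b := a) (by rw [add_comm, hab])).symm
  left := h.right
  right := h.left
  ortho := by rw [lieForm_comm, h.ortho]

theorem compZero_unitPointCombDeriv {u u' v : V} (h0 : compZero (pointComb u v) ≠ 0) :
    compZero (unitPointCombDeriv u u' v) = 0 := by
  simp only [unitPointCombDeriv, compZero_smul, compZero_sub, unitPointComb]
  field_simp; ring

theorem compR_unitPointCombDeriv (u u' v : V) : compR (unitPointCombDeriv u u' v) = 0 := by
  simp only [unitPointCombDeriv, compR_smul, compR_sub, unitPointComb, compR_pointComb]; ring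

/-- The equation of Rodrigues for a contact element with one fixed sphere. -/
theorem rodrigues {u u' v : V} (h0 : compZero (pointComb u v) ≠ 0) :
    compZero v • unitPointCombDeriv u u' v + compR v • planeCombDeriv u u' v = 0 := by
  -- This is the derivative of `v = μ x̂ + r n̂` for constant `v`. The terms are grouped so that the
  -- derivative of the common denominator multiplies this combination, which is `v` again.
  have e : compZero v • unitPointCombDeriv u u' v + compR v • planeCombDeriv u u' v =
      (compZero (pointComb u v))⁻¹ • (compZero v • pointComb u' v +
        compR v • (compZero u' • v - compZero v • u') - compZero (pointComb u' v) •
        (compZero v • unitPointComb u v + compR v • planeComb u v)) := by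
    simp only [unitPointCombDeriv, planeCombDeriv]; module
  rw [e, right_eq_comb h0, compZero_pointComb u' v]
  simp only [pointComb]
  module

/-- Without `e₀`-components the `e∞`-parts do not contribute, and one missing `e_r`-component
removes the remaining term. Euclidean metric statements become statements about the Lie form. -/
theorem inner_spatial {u v : V} (hu : compZero u = 0) (hv : compZero v = 0) (hr : compR v = 0) :
    inner ℝ (spatial u) (spatial v) = lieForm u v := by
  simp only [compZero, compR] at hu hv hr
  have hu4 : u 4 = u 3 := by linarith
  have hv4 : v 4 = v 3 := by linarith
  rw [inner_E3, lieForm_apply, hu4, hv4, hr]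
  simp

/-- Only the coefficient of `u'` has to be explicit: in the products below, the vectors of the
contact element contribute nothing. -/
theorem exists_unitPointCombDeriv_eq (u u' v : V) : ∃ a b : ℝ, unitPointCombDeriv u u' v =
    ((compZero (pointComb u v))⁻¹ * compR v) • u' + a • u + b • v := by
  refine ⟨-((compZero (pointComb u v))⁻¹ * compZero (pointComb u' v) *
    ((compZero (pointComb u v))⁻¹ * compR v)),
    (compZero (pointComb u v))⁻¹ * (-compR u' + compZero (pointComb u' v) *
    ((compZero (pointComb u v))⁻¹ * compR u)), ?_⟩
  rw [unitPointCombDeriv, unitPointComb_eq, pointComb_eq u' v]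
  module

/-- `u'` and `v'` are directions in which the spheres `u` and `v` of a contact element can move
while they remain in contact, and the two motions are orthogonal. -/
structure ContactMotion (u v u' v' : V) : Prop extends SpansContact u v where
  left_left : lieForm u u' = 0
  right_right : lieForm v v' = 0
  right_left : lieForm v u' = 0
  left_right : lieForm u v' = 0
  motions : lieForm u' v' = 0
  left_ne : lieForm u' u' ≠ 0
  right_ne : lieForm v' v' ≠ 0

namespace ContactMotion

variable {u v u' v' : V}

theorem swap (h : ContactMotion u v u' v') : ContactMotion v u v' u' where
  toSpansContact := h.toSpansContact.symm
  left_left := h.right_right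
  right_right := h.left_left
  right_left := h.left_right
  left_right := h.right_left
  motions := by rw [lieForm_comm, h.motions]
  left_ne := h.right_ne
  right_ne := h.left_ne

theorem inner_normal (h : ContactMotion u v u' v') (h0 : compZero (pointComb u v) ≠ 0) :
    inner ℝ (spatial (planeComb u v)) (spatial (unitPointCombDeriv u u' v)) = 0 := by
  rw [inner_spatial (compZero_planeComb u v) (compZero_unitPointCombDeriv h0)
    (compR_unitPointCombDeriv u u' v), planeComb_eq]
  obtain ⟨a, b, e⟩ := exists_unitPointCombDeriv_eq u u' v
  rw [e]
  simp [h.left, h.right, h.ortho, lieForm_comm v u, h.left_left, h.right_left]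

/-- The squared length of the derivative is `(r(v) / ν)² ⟨u', u'⟩`. -/
theorem deriv_eq_zero_iff (h : ContactMotion u v u' v') (h0 : compZero (pointComb u v) ≠ 0) :
    spatial (unitPointCombDeriv u u' v) = 0 ↔ compR v = 0 := by
  rw [← inner_self_eq_zero (𝕜 := ℝ), inner_spatial (compZero_unitPointCombDeriv h0)
    (compZero_unitPointCombDeriv h0) (compR_unitPointCombDeriv u u' v)]
  obtain ⟨a, b, e⟩ := exists_unitPointCombDeriv_eq u u' v
  rw [e]
  simp [h.left, h.right, h.ortho, lieForm_comm v u, h.left_left, h.right_left,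
    lieForm_comm u' u, lieForm_comm u' v, h.left_ne, h0]

theorem inner_derivs (h : ContactMotion u v u' v') (h0 : compZero (pointComb u v) ≠ 0) :
    inner ℝ (spatial (unitPointCombDeriv u u' v)) (spatial (unitPointCombDeriv v v' u)) = 0 := by
  have h0' : compZero (pointComb v u) ≠ 0 := by
    rw [pointComb_swap, compZero_neg]; exact neg_ne_zero.2 h0
  rw [inner_spatial (compZero_unitPointCombDeriv h0)
    (compZero_unitPointCombDeriv h0') (compR_unitPointCombDeriv v v' u)]
  obtain ⟨a, b, e⟩ := exists_unitPointCombDeriv_eq u u' v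
  obtain ⟨a', b', e'⟩ := exists_unitPointCombDeriv_eq v v' u
  rw [e, e']
  simp [h.left, h.right, h.ortho, lieForm_comm v u, h.left_left, h.right_left,
    lieForm_comm u' u, lieForm_comm u' v, h.motions, h.left_right, h.right_right]

end ContactMotion

/-- The principal curvature is the reciprocal oriented radius of the resting sphere `v`, and zero if
`v` is a plane. -/
theorem spatial_rodrigues {u u' v : V} (h0 : compZero (pointComb u v) ≠ 0) (hr : compR v ≠ 0) :
    spatial (planeCombDeriv u u' v) =
      -(compZero v / compR v) • spatial (unitPointCombDeriv u u' v) := by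
  have h := congrArg spatialL (rodrigues (u' := u') h0)
  simp only [map_add, map_smul, map_zero, spatialL_apply] at h
  have h2 := congrArg ((compR v)⁻¹ • ·) (eq_neg_of_add_eq_zero_right h)
  simp only [inv_smul_smul₀ hr] at h2
  rw [h2]
  match_scalars; field_simp

/-! ### The Euclidean surface of contact points -/

section Surface

variable {σ τ σ' τ' : ℝ → V}

/-- The point of contact of the spheres `σ` and `τ`. -/
noncomputable def contactPoint (σ τ : ℝ → V) (q : ℝ × ℝ) : E3 :=
  spatial (unitPointComb (σ q.1) (τ q.2))

/-- The unit normal at the point of contact of the spheres `σ` and `τ`. -/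
noncomputable def contactNormal (σ τ : ℝ → V) (q : ℝ × ℝ) : E3 :=
  spatial (planeComb (σ q.1) (τ q.2))

theorem contDiffAt_contactPoint {n : WithTop ℕ∞} (hσ : ContDiff ℝ n σ) (hτ : ContDiff ℝ n τ)
    {p : ℝ × ℝ} (h0 : compZero (pointComb (σ p.1) (τ p.2)) ≠ 0) :
    ContDiffAt ℝ n (contactPoint σ τ) p :=
  contDiff_spatial.contDiffAt.comp p
    (contDiffAt_unitPointComb (hσ.comp contDiff_fst) (hτ.comp contDiff_snd) h0)

theorem contDiffAt_contactNormal {n : WithTop ℕ∞} (hσ : ContDiff ℝ n σ) (hτ : ContDiff ℝ n τ)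
    {p : ℝ × ℝ} (h0 : compZero (pointComb (σ p.1) (τ p.2)) ≠ 0) :
    ContDiffAt ℝ n (contactNormal σ τ) p :=
  contDiff_spatial.contDiffAt.comp p
    (contDiffAt_planeComb (hσ.comp contDiff_fst) (hτ.comp contDiff_snd) h0)

variable (hσ : ContDiff ℝ ((⊤ : ℕ∞) : WithTop ℕ∞) σ) (hτ : ContDiff ℝ ((⊤ : ℕ∞) : WithTop ℕ∞) τ)
  {p : ℝ × ℝ} (h0 : compZero (pointComb (σ p.1) (τ p.2)) ≠ 0)

include hσ hτ h0

theorem d₁_contactPoint (h : HasDerivAt σ (σ' p.1) p.1) : d₁ (contactPoint σ τ) p =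
    spatial (unitPointCombDeriv (σ p.1) (σ' p.1) (τ p.2)) :=
  d₁_eq ((contDiffAt_contactPoint hσ hτ h0).differentiableAt (by simp))
    (hasDerivAt_spatial (hasDerivAt_unitPointComb h _ h0))

theorem d₁_contactNormal (h : HasDerivAt σ (σ' p.1) p.1) : d₁ (contactNormal σ τ) p =
    spatial (planeCombDeriv (σ p.1) (σ' p.1) (τ p.2)) :=
  d₁_eq ((contDiffAt_contactNormal hσ hτ h0).differentiableAt (by simp))
    (hasDerivAt_spatial (hasDerivAt_planeComb h _ h0))

theorem d₂_contactPoint (h : HasDerivAt τ (τ' p.2) p.2) : d₂ (contactPoint σ τ) p =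
    spatial (unitPointCombDeriv (τ p.2) (τ' p.2) (σ p.1)) := by
  refine d₂_eq ((contDiffAt_contactPoint hσ hτ h0).differentiableAt (by simp)) ?_
  simp only [contactPoint, ← unitPointComb_swap (σ p.1)]
  exact hasDerivAt_spatial (hasDerivAt_unitPointComb h _
    (by rw [pointComb_swap, compZero_neg]; exact neg_ne_zero.2 h0))

theorem d₂_contactNormal (h : HasDerivAt τ (τ' p.2) p.2) : d₂ (contactNormal σ τ) p =
    spatial (planeCombDeriv (τ p.2) (τ' p.2) (σ p.1)) := by
  refine d₂_eq ((contDiffAt_contactNormal hσ hτ h0).differentiableAt (by simp)) ?_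
  simp only [contactNormal, ← planeComb_swap (σ p.1)]
  exact hasDerivAt_spatial (hasDerivAt_planeComb h _
    (by rw [pointComb_swap, compZero_neg]; exact neg_ne_zero.2 h0))

/-- Each partial derivative vanishes exactly when the sphere that rests in its direction is a point
sphere. If neither vanishes, their orthogonality gives independence. -/
theorem isCurvatureLineParamAt_contactPoint_iff
    (h₁ : ∀ t, HasDerivAt σ (σ' t) t) (h₂ : ∀ t, HasDerivAt τ (τ' t) t)
    (h : ∀ q : ℝ × ℝ, ContactMotion (σ q.1) (τ q.2) (σ' q.1) (τ' q.2)) :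
    IsCurvatureLineParamAt (contactPoint σ τ) (contactNormal σ τ) p ↔
      compR (σ p.1) ≠ 0 ∧ compR (τ p.2) ≠ 0 := by
  have swap {q : ℝ × ℝ} (hq : compZero (pointComb (σ q.1) (τ q.2)) ≠ 0) :
      compZero (pointComb (τ q.2) (σ q.1)) ≠ 0 := by
    rw [pointComb_swap, compZero_neg]; exact neg_ne_zero.2 hq
  constructor
  · rintro ⟨-, -, -, hind, -⟩
    rw [d₁_contactPoint hσ hτ h0 (h₁ _), d₂_contactPoint hσ hτ h0 (h₂ _)] at hind
    constructor
    · intro hr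
      exact hind.ne_zero 1 (((h p).swap.deriv_eq_zero_iff (swap h0)).2 hr)
    · intro hr
      exact hind.ne_zero 0 (((h p).deriv_eq_zero_iff h0).2 hr)
  · rintro ⟨hr₁, hr₂⟩
    have ev : ∀ᶠ q : ℝ × ℝ in nhds p, compZero (pointComb (σ q.1) (τ q.2)) ≠ 0 :=
      (contDiff_compZero.comp (contDiff_pointComb (hσ.comp contDiff_fst)
        (hτ.comp contDiff_snd))).continuous.continuousAt.eventually_ne h0
    refine ⟨contDiffAt_contactPoint hσ hτ h0, contDiffAt_contactNormal hσ hτ h0, ?_, ?_, ?_,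
      compZero (τ p.2) / compR (τ p.2), compZero (σ p.1) / compR (σ p.1), ?_, ?_⟩
    · filter_upwards [ev] with q hq
      rw [d₁_contactPoint hσ hτ hq (h₁ _), d₂_contactPoint hσ hτ hq (h₂ _)]
      refine ⟨(h q).norm_normal hq, (h q).inner_normal hq, ?_⟩
      rw [contactNormal, ← planeComb_swap]
      exact (h q).swap.inner_normal (swap hq)
    · rw [d₁_contactPoint hσ hτ h0 (h₁ _), d₂_contactPoint hσ hτ h0 (h₂ _)]
      refine linearIndependent_of_ne_zero_of_inner_eq_zero (𝕜 := ℝ) ?_ ?_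
      · intro i
        fin_cases i
        · exact fun e => hr₂ (((h p).deriv_eq_zero_iff h0).1 e)
        · exact fun e => hr₁ (((h p).swap.deriv_eq_zero_iff (swap h0)).1 e)
      · intro i j hij
        fin_cases i <;> fin_cases j
        · exact absurd rfl hij
        · exact (h p).inner_derivs h0
        · exact (h p).swap.inner_derivs (swap h0)
        · exact absurd rfl hij
    · rw [d₁_contactPoint hσ hτ h0 (h₁ _), d₂_contactPoint hσ hτ h0 (h₂ _)]
      exact (h p).inner_derivs h0
    · rw [d₁_contactPoint hσ hτ h0 (h₁ _), d₁_contactNormal hσ hτ h0 (h₁ _)]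
      exact spatial_rodrigues h0 hr₂
    · rw [d₂_contactPoint hσ hτ h0 (h₂ _), d₂_contactNormal hσ hτ h0 (h₂ _)]
      exact spatial_rodrigues (swap h0) hr₁

end Surface

/-- The family of contact elements spanned by two families of spheres is a curvature line
parametrization. -/
theorem isLieCurvatureLineParamAt_of_contactMotion {σ τ σ' τ' : ℝ → V}
    (hσ : ContDiff ℝ ((⊤ : ℕ∞) : WithTop ℕ∞) σ) (hτ : ContDiff ℝ ((⊤ : ℕ∞) : WithTop ℕ∞) τ)
    (h₁ : ∀ t, HasDerivAt σ (σ' t) t) (h₂ : ∀ t, HasDerivAt τ (τ' t) t)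
    (h : ∀ q : ℝ × ℝ, ContactMotion (σ q.1) (τ q.2) (σ' q.1) (τ' q.2))
    {L : ℝ × ℝ → Submodule ℝ V} (hL : ∀ q, L q = Submodule.span ℝ {σ q.1, τ q.2})
    {K₁ K₂ : ℙ ℝ V} {p : ℝ × ℝ} (hK₁ : K₁.submodule = Submodule.span ℝ {σ p.1})
    (hK₂ : K₂.submodule = Submodule.span ℝ {τ p.2}) :
    IsLieCurvatureLineParamAt L K₁ K₂ p := by
  have e₁ (X : ℝ × ℝ) : fderiv ℝ (fun q : ℝ × ℝ => σ q.1) p X = X.1 • σ' p.1 := by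
    rw [(hasFDerivAt_comp_fst (h₁ p.1)).fderiv]; simp
  have e₂ (X : ℝ × ℝ) : fderiv ℝ (fun q : ℝ × ℝ => τ q.2) p X = X.2 • τ' p.2 := by
    rw [(hasFDerivAt_comp_snd (h₂ p.2)).fderiv]; simp
  have hp := h p
  -- Pairing with a vector `x` orthogonal to the contact element detects `c`; it is applied with `w
  -- = x` equal to `σ'` or `τ'`.
  have key {w x : V} {c : ℝ} (hw : c • w ∈ Submodule.span ℝ {σ p.1, τ p.2})
      (hwx : lieForm w x ≠ 0) (hx₁ : lieForm (σ p.1) x = 0) (hx₂ : lieForm (τ p.2) x = 0) :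
      c = 0 := by
    obtain ⟨a, b, e⟩ := Submodule.mem_span_pair.1 hw
    have := congrArg (fun y => lieForm y x) e
    simpa [hx₁, hx₂, hwx] using this
  refine ⟨fun q => σ q.1, fun q => τ q.2, (hσ.comp contDiff_fst).contDiffAt,
    (hτ.comp contDiff_snd).contDiffAt, Filter.Eventually.of_forall fun q => ⟨(h q).indep, hL q, ?_⟩,
    ?_, ?_, hK₁, ?_, hK₂, ?_⟩
  · rw [hL]; exact (h q).isContactElement
  · intro X
    rw [e₁]
    simp [lieForm_comm _ (τ p.2), hp.right_left]
  · intro X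
    rw [e₁, e₂, hL]
    intro hX₁ hX₂
    exact Prod.ext (key hX₁ hp.left_ne hp.left_left hp.right_left)
      (key hX₂ hp.right_ne hp.left_right hp.right_right)
  -- The sphere does not move in this direction, so the derivative is zero.
  · rw [d₂, e₁]; simp
  · rw [d₁, e₂]; simp

/-! ### Points of projective space -/

theorem isPointSphere_mk {v : V} (hv : v ≠ 0) :
    IsPointSphere (Projectivization.mk ℝ v hv) ↔ lieForm v v = 0 ∧ compR v = 0 := by
  obtain ⟨a, ha⟩ := Projectivization.exists_smul_eq_mk_rep ℝ v hv
  rw [Units.smul_def] at ha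
  rw [IsPointSphere, ← ha, compR_smul]
  simp

theorem DupinCyclide.mk_mem_family {D : DupinCyclide} {i : Fin 2} {v : V} (hv : v ≠ 0) :
    Projectivization.mk ℝ v hv ∈ D.family i ↔ v ∈ D.P i ∧ lieForm v v = 0 := by
  obtain ⟨a, ha⟩ := Projectivization.exists_smul_eq_mk_rep ℝ v hv
  rw [Units.smul_def] at ha
  simp only [DupinCyclide.family, Set.mem_ofPred_eq, ← ha, Projectivization.submodule_mk,
    Submodule.span_singleton_le_iff_mem]
  simp

theorem inc_mk {u v : V} (hu : u ≠ 0) (hv : v ≠ 0) :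
    inc (Projectivization.mk ℝ u hu) (Projectivization.mk ℝ v hv) = Submodule.span ℝ {u, v} := by
  rw [inc, Projectivization.submodule_mk, Projectivization.submodule_mk, Submodule.span_insert]

/-! ### Polar planes -/

namespace DupinCyclide

variable {D : DupinCyclide} {u v w : V}

theorem lieForm_eq_zero (hu : u ∈ D.P 0) (hv : v ∈ D.P 1) : lieForm u v = 0 := by
  rw [D.polar] at hv
  exact hv u hu

theorem eq_zero_of_mem (h₀ : u ∈ D.P 0) (h₁ : u ∈ D.P 1) : u = 0 :=
  (D.signature 0).eq_zero h₀ fun _ hw => lieForm_eq_zero hw h₁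

theorem spansContact (hu : u ∈ D.P 0) (hv : v ∈ D.P 1) (hu0 : u ≠ 0) (hv0 : v ≠ 0)
    (huu : lieForm u u = 0) (hvv : lieForm v v = 0) : SpansContact u v where
  indep := by
    rw [LinearIndependent.pair_iff]
    intro a b hab
    have h1 : a • u = 0 := by
      refine D.eq_zero_of_mem ((D.P 0).smul_mem a hu) ?_
      rw [eq_neg_of_add_eq_zero_left hab]
      exact (D.P 1).neg_mem ((D.P 1).smul_mem b hv)
    rw [h1, zero_add] at hab
    exact ⟨(smul_eq_zero.1 h1).resolve_right hu0, (smul_eq_zero.1 hab).resolve_right hv0⟩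
  left := huu
  right := hvv
  ortho := lieForm_eq_zero hu hv

/-- The contact element meets the plane only in the line of `u`, so it determines its sphere of this
family. -/
theorem exists_smul_left (hu : u ∈ D.P 0) (hv : v ∈ D.P 1) (hw : w ∈ D.P 0)
    (h : w ∈ Submodule.span ℝ {u, v}) : ∃ a : ℝ, a • u = w := by
  obtain ⟨a, b, rfl⟩ := Submodule.mem_span_pair.1 h
  refine ⟨a, ?_⟩
  rw [D.eq_zero_of_mem (u := b • v) (by simpa using (D.P 0).sub_mem hw ((D.P 0).smul_mem a hu))
    ((D.P 1).smul_mem b hv), add_zero]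

theorem exists_smul_right (hu : u ∈ D.P 0) (hv : v ∈ D.P 1) (hw : w ∈ D.P 1)
    (h : w ∈ Submodule.span ℝ {u, v}) : ∃ b : ℝ, b • v = w := by
  obtain ⟨a, b, rfl⟩ := Submodule.mem_span_pair.1 h
  refine ⟨b, ?_⟩
  rw [D.eq_zero_of_mem (u := a • u) ((D.P 0).smul_mem a hu)
    (by simpa using (D.P 1).sub_mem hw ((D.P 1).smul_mem b hv)), zero_add]

end DupinCyclide

/-- A quadratic radius function that does not vanish identically has finitely many zeros. -/
theorem finite_radiusFun_eq_zero {S : Fin 3 → V} {t₀ : OnePoint ℝ} (h₀ : radiusFun S t₀ ≠ 0) :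
    {t | radiusFun S t = 0}.Finite := by
  let w (j : Fin 3) : ℝ := compR (S j) * weight S j
  let p : Polynomial ℝ := Polynomial.C (2 * w 0 - w 1 + 2 * w 2) * Polynomial.X ^ 2 +
    Polynomial.C (-3 * w 0 + w 1 - w 2) * Polynomial.X + Polynomial.C (w 0)
  have hr (t : OnePoint ℝ) : radiusFun S t = ∑ j, w j * quadCoeff t j := rfl
  have hp : p ≠ 0 := by
    intro h
    -- The values at `0`, `1` and `-1` are `w₀`, `w₂` and `6w₀ - 2w₁ + 3w₂`, so all three `w j`
    -- vanish. This also covers `t₀ = ∞`.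
    have c0 := congrArg (Polynomial.eval 0) h
    have c1 := congrArg (Polynomial.eval 1) h
    have c2 := congrArg (Polynomial.eval (-1)) h
    simp [p] at c0 c1 c2
    refine h₀ ?_
    rw [hr, Fin.sum_univ_three, c0, show w 1 = 0 by linarith, show w 2 = 0 by linarith]
    ring
  refine ((Polynomial.finite_setOfPred_isRoot hp).image
    (fun x : ℝ => (x : OnePoint ℝ))).insert OnePoint.infty |>.subset ?_
  intro t ht
  induction t using OnePoint.rec with
  | infty => exact Set.mem_insert _ _
  | coe x =>
    refine Set.mem_insert_of_mem _ ⟨x, ?_, rfl⟩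
    have ht : radiusFun S (x : OnePoint ℝ) = 0 := ht
    rw [hr, Fin.sum_univ_three, quadCoeff_coe] at ht
    simp only [Matrix.cons_val] at ht
    simp only [Set.mem_ofPred_eq, Polynomial.IsRoot, p, Polynomial.eval_add, Polynomial.eval_mul,
      Polynomial.eval_C, Polynomial.eval_pow, Polynomial.eval_X]
    linarith

/-! ### The parametrization of the cyclide -/

theorem contactVec_eq (S : Fin 2 → Fin 3 → V) (t₁ t₂ : OnePoint ℝ) :
    contactVec S t₁ t₂ = pointComb (conicVec (S 0) t₁) (conicVec (S 1) t₂) := by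
  rw [contactVec, pointComb, compR_conicVec, compR_conicVec]

theorem contactScale_eq (S : Fin 2 → Fin 3 → V) (t₁ t₂ : OnePoint ℝ) : contactScale S t₁ t₂ =
    compZero (pointComb (conicVec (S 0) t₁) (conicVec (S 1) t₂)) := by
  rw [compZero_pointComb, contactScale]; simp only [compR_conicVec, compZero_conicVec]

theorem xHat_eq (S : Fin 2 → Fin 3 → V) (t₁ t₂ : OnePoint ℝ) :
    xHat S t₁ t₂ = unitPointComb (conicVec (S 0) t₁) (conicVec (S 1) t₂) := by
  rw [xHat, unitPointComb, contactVec_eq, contactScale_eq]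

/-- The normalized point is invariant under rescaling of both spheres, so smooth representatives may
replace those with denominators. -/
theorem xPoint_chart (S : Fin 2 → Fin 3 → V) (k₁ k₂ : Fin 2) :
    (fun q : ℝ × ℝ => xPoint S (chart k₁ q.1) (chart k₂ q.2)) =
      contactPoint (polyVec (S 0) k₁) (polyVec (S 1) k₂) := by
  ext1 q
  obtain ⟨c, hc, e⟩ := exists_conicVec_chart (S 0) k₁ q.1
  obtain ⟨c', hc', e'⟩ := exists_conicVec_chart (S 1) k₂ q.2
  rw [xPoint, xHat_eq, contactPoint, e, e', unitPointComb_smul hc hc']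

theorem planeComb_chart (S : Fin 2 → Fin 3 → V) (k₁ k₂ : Fin 2) :
    (fun q : ℝ × ℝ => spatial (planeComb (conicVec (S 0) (chart k₁ q.1))
      (conicVec (S 1) (chart k₂ q.2)))) =
      contactNormal (polyVec (S 0) k₁) (polyVec (S 1) k₂) := by
  ext1 q
  obtain ⟨c, hc, e⟩ := exists_conicVec_chart (S 0) k₁ q.1
  obtain ⟨c', hc', e'⟩ := exists_conicVec_chart (S 1) k₂ q.2
  rw [contactNormal, e, e', planeComb_smul hc hc']

theorem compZero_pointComb_polyVec_ne {S : Fin 2 → Fin 3 → V} {k₁ k₂ : Fin 2} {x y : ℝ}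
    (h : contactScale S (chart k₁ x) (chart k₂ y) ≠ 0) :
    compZero (pointComb (polyVec (S 0) k₁ x) (polyVec (S 1) k₂ y)) ≠ 0 := by
  obtain ⟨c, -, e⟩ := exists_conicVec_chart (S 0) k₁ x
  obtain ⟨c', -, e'⟩ := exists_conicVec_chart (S 1) k₂ y
  rw [contactScale_eq, e, e', pointComb_smul, compZero_smul] at h
  exact right_ne_zero_of_mul h

theorem span_conicVec_chart (S : Fin 3 → V) (k : Fin 2) (u : ℝ) :
    Submodule.span ℝ {conicVec S (chart k u)} = Submodule.span ℝ {polyVec S k u} := by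
  obtain ⟨c, hc, e⟩ := exists_conicVec_chart S k u
  rw [e, Submodule.span_singleton_smul_eq hc.isUnit]

theorem compR_polyVec_eq_zero_iff (S : Fin 3 → V) (k : Fin 2) (u : ℝ) :
    compR (polyVec S k u) = 0 ↔ compR (conicVec S (chart k u)) = 0 := by
  obtain ⟨c, hc, e⟩ := exists_conicVec_chart S k u
  rw [e, compR_smul]
  simp [hc]

/-- Derivatives stay in the plane of their family, so polarity kills all mixed products; the rest is
known on each conic. -/
theorem DupinCyclide.contactMotion {D : DupinCyclide} {S : Fin 2 → Fin 3 → V}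
    (hT : ∀ i, IsConicTriple (D.P i) (S i)) (k₁ k₂ : Fin 2) (x y : ℝ) :
    ContactMotion (polyVec (S 0) k₁ x) (polyVec (S 1) k₂ y)
      (polyVecDeriv (S 0) k₁ x) (polyVecDeriv (S 1) k₂ y) where
  toSpansContact := D.spansContact ((hT 0).polyVec_mem k₁ x) ((hT 1).polyVec_mem k₂ y)
    ((hT 0).polyVec_ne_zero k₁ x) ((hT 1).polyVec_ne_zero k₂ y)
    ((hT 0).lieForm_polyVec k₁ x) ((hT 1).lieForm_polyVec k₂ y)
  left_left := (hT 0).lieForm_polyVec_deriv k₁ x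
  right_right := (hT 1).lieForm_polyVec_deriv k₂ y
  right_left := by
    rw [lieForm_comm]
    exact D.lieForm_eq_zero ((hT 0).polyVecDeriv_mem k₁ x) ((hT 1).polyVec_mem k₂ y)
  left_right := D.lieForm_eq_zero ((hT 0).polyVec_mem k₁ x) ((hT 1).polyVecDeriv_mem k₂ y)
  motions := D.lieForm_eq_zero ((hT 0).polyVecDeriv_mem k₁ x) ((hT 1).polyVecDeriv_mem k₂ y)
  left_ne := (hT 0).lieForm_polyVecDeriv k₁ x
  right_ne := (hT 1).lieForm_polyVecDeriv k₂ y

/-- The point of the conic through `S` with the parameter `t`. -/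
noncomputable def IsConicTriple.point {P : Submodule ℝ V} {S : Fin 3 → V}
    (h : IsConicTriple P S) (t : OnePoint ℝ) : ℙ ℝ V :=
  Projectivization.mk ℝ (conicVec S t) (h.conicVec_ne_zero t)

theorem IsConicTriple.point_eq_mk {P : Submodule ℝ V} {S : Fin 3 → V} (h : IsConicTriple P S)
    {t : OnePoint ℝ} {v : V} {a : ℝ} (hv : v ≠ 0) (e : conicVec S t = a • v) :
    h.point t = Projectivization.mk ℝ v hv :=
  (Projectivization.mk_eq_mk_iff' ℝ _ _ _ hv).2 ⟨a, e.symm⟩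

theorem IsConicTriple.isPointSphere_point {P : Submodule ℝ V} {S : Fin 3 → V}
    (h : IsConicTriple P S) (t : OnePoint ℝ) :
    IsPointSphere (h.point t) ↔ compR (conicVec S t) = 0 := by
  rw [IsConicTriple.point, isPointSphere_mk]
  simp [h.lieForm_conicVec]

section Cyclide

variable {D : DupinCyclide} {S : Fin 2 → Fin 3 → V} (hT : ∀ i, IsConicTriple (D.P i) (S i))

include hT

theorem bijOn_point (i : Fin 2) : Set.BijOn (hT i).point Set.univ (D.family i) := by
  refine ⟨fun t _ => D.mk_mem_family _ |>.2 ⟨(hT i).conicVec_mem t, (hT i).lieForm_conicVec t⟩,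
    fun t _ t' _ e => ?_, fun p hp => ?_⟩
  · obtain ⟨a, ha⟩ := (Projectivization.mk_eq_mk_iff' ℝ _ _ _ _).1 e
    exact ((hT i).conicVec_injective ha).symm
  · induction p using Projectivization.ind with
    | h v hv =>
    rw [D.mk_mem_family] at hp
    obtain ⟨t, c, e⟩ := (hT i).conicVec_surjective hp.1 hp.2
    refine ⟨t, Set.mem_univ t, ?_⟩
    exact ((Projectivization.mk_eq_mk_iff' ℝ _ _ hv _).2 ⟨c, e.symm⟩).symm

theorem spansContact_conicVec (t₁ t₂ : OnePoint ℝ) :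
    SpansContact (conicVec (S 0) t₁) (conicVec (S 1) t₂) :=
  D.spansContact ((hT 0).conicVec_mem t₁) ((hT 1).conicVec_mem t₂) ((hT 0).conicVec_ne_zero t₁)
    ((hT 1).conicVec_ne_zero t₂) ((hT 0).lieForm_conicVec t₁) ((hT 1).lieForm_conicVec t₂)

theorem inc_point (t₁ t₂ : OnePoint ℝ) : inc ((hT 0).point t₁) ((hT 1).point t₂) =
    Submodule.span ℝ {conicVec (S 0) t₁, conicVec (S 1) t₂} :=
  inc_mk _ _

theorem bijOn_inc_point : Set.BijOn
    (fun t : OnePoint ℝ × OnePoint ℝ => inc ((hT 0).point t.1) ((hT 1).point t.2)) Set.univ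
      D.contactElements := by
  refine ⟨fun t _ => ⟨_, (bijOn_point hT 0).mapsTo (Set.mem_univ _), _,
    (bijOn_point hT 1).mapsTo (Set.mem_univ _), rfl⟩, fun t _ t' _ e => ?_, ?_⟩
  · simp only [inc_point hT] at e
    have h₀ : conicVec (S 0) t'.1 ∈ Submodule.span ℝ {conicVec (S 0) t.1, conicVec (S 1) t.2} := by
      rw [e]; exact Submodule.subset_span (by simp)
    have h₁ : conicVec (S 1) t'.2 ∈ Submodule.span ℝ {conicVec (S 0) t.1, conicVec (S 1) t.2} := by
      rw [e]; exact Submodule.subset_span (by simp)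
    obtain ⟨a, ha⟩ := D.exists_smul_left ((hT 0).conicVec_mem _) ((hT 1).conicVec_mem _)
      ((hT 0).conicVec_mem _) h₀
    obtain ⟨b, hb⟩ := D.exists_smul_right ((hT 0).conicVec_mem _) ((hT 1).conicVec_mem _)
      ((hT 1).conicVec_mem _) h₁
    exact Prod.ext ((hT 0).conicVec_injective ha) ((hT 1).conicVec_injective hb)
  · rintro W ⟨p, hp, q, hq, rfl⟩
    obtain ⟨t₁, -, rfl⟩ := (bijOn_point hT 0).surjOn hp
    obtain ⟨t₂, -, rfl⟩ := (bijOn_point hT 1).surjOn hq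
    exact ⟨(t₁, t₂), Set.mem_univ _, rfl⟩

theorem isLieCurvatureLineParamAt_inc_point (k₁ k₂ : Fin 2) (p : ℝ × ℝ) :
    IsLieCurvatureLineParamAt
      (fun q => inc ((hT 0).point (chart k₁ q.1)) ((hT 1).point (chart k₂ q.2)))
      ((hT 0).point (chart k₁ p.1)) ((hT 1).point (chart k₂ p.2)) p := by
  refine isLieCurvatureLineParamAt_of_contactMotion (contDiff_polyVec (S 0) k₁)
    (contDiff_polyVec (S 1) k₂) (hasDerivAt_polyVec (S 0) k₁) (hasDerivAt_polyVec (S 1) k₂)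
    (fun q => D.contactMotion hT k₁ k₂ q.1 q.2) (fun q => ?_) ?_ ?_
  · rw [inc_point, Submodule.span_insert, span_conicVec_chart, span_conicVec_chart,
      ← Submodule.span_insert]
  · rw [IsConicTriple.point, Projectivization.submodule_mk, span_conicVec_chart]
  · rw [IsConicTriple.point, Projectivization.submodule_mk, span_conicVec_chart]

theorem pointSphere_iff (t₁ t₂ : OnePoint ℝ) (h : contactVec S t₁ t₂ ≠ 0) (p : ℙ ℝ V) :
    p.submodule ≤ inc ((hT 0).point t₁) ((hT 1).point t₂) ∧ IsPointSphere p ↔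
      p = Projectivization.mk ℝ (contactVec S t₁ t₂) h := by
  have hc := spansContact_conicVec hT t₁ t₂
  rw [inc_point]
  constructor
  · induction p using Projectivization.ind with
    | h v hv =>
    rintro ⟨hle, hp⟩
    rw [Projectivization.submodule_mk, Submodule.span_singleton_le_iff_mem] at hle
    obtain ⟨c, e⟩ := hc.exists_smul_pointComb hle ((isPointSphere_mk hv).1 hp).2
    rw [← contactVec_eq] at e
    exact (Projectivization.mk_eq_mk_iff' ℝ _ _ hv h).2 ⟨c, e.symm⟩
  · rintro rfl
    rw [Projectivization.submodule_mk, Submodule.span_singleton_le_iff_mem, isPointSphere_mk,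
      contactVec_eq]
    exact ⟨pointComb_mem _ _, hc.lieForm_pointComb, compR_pointComb _ _⟩

theorem xHat_eq_pointVec {t₁ t₂ : OnePoint ℝ} (h0 : contactScale S t₁ t₂ ≠ 0) :
    xHat S t₁ t₂ = pointVec (xPoint S t₁ t₂) := by
  rw [contactScale_eq] at h0
  rw [xPoint, xHat_eq]
  exact (spansContact_conicVec hT t₁ t₂).unitPointComb_eq_pointVec h0

theorem setOf_xPoint_eq :
    {x | ∃ t₁ t₂, contactScale S t₁ t₂ ≠ 0 ∧ x = xPoint S t₁ t₂} = D.points := by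
  ext x
  constructor
  · rintro ⟨t₁, t₂, h0, rfl⟩
    refine ⟨_, (bijOn_inc_point hT).mapsTo (Set.mem_univ (t₁, t₂)), ?_⟩
    simp only [inc_point]
    rw [← xHat_eq_pointVec hT h0, xHat_eq]
    exact Submodule.smul_mem _ _ (pointComb_mem _ _)
  · rintro ⟨W, hW, hx⟩
    obtain ⟨⟨t₁, t₂⟩, -, rfl⟩ := (bijOn_inc_point hT).surjOn hW
    simp only [inc_point] at hx
    obtain ⟨c, e⟩ := (spansContact_conicVec hT t₁ t₂).exists_smul_pointComb hx
      (compR_pointVec x)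
    have h1 := congrArg compZero e
    rw [compZero_pointVec, compZero_smul, ← contactScale_eq] at h1
    have h0 : contactScale S t₁ t₂ ≠ 0 := by
      intro h
      rw [h, mul_zero] at h1
      exact one_ne_zero h1
    refine ⟨t₁, t₂, h0, ?_⟩
    -- Comparison of the `e₀`-components shows that `c` is the normalizing factor of `x̂`.
    have hc : (contactScale S t₁ t₂)⁻¹ = c := by field_simp; linarith
    rw [xPoint, xHat, contactVec_eq, hc, ← e, spatial_pointVec]

end Cyclide

theorem IsConicTriple.exists_sphereVec {P : Submodule ℝ V} {S : Fin 3 → V}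
    (h : IsConicTriple P S) {t : OnePoint ℝ} (h0 : scaleFun S t ≠ 0) :
    ∃ c : E3, (scaleFun S t)⁻¹ • conicVec S t = sphereVec c (radiusFun S t / scaleFun S t) := by
  have hr : compR ((scaleFun S t)⁻¹ • conicVec S t) = radiusFun S t / scaleFun S t := by
    rw [compR_smul, compR_conicVec, div_eq_inv_mul]
  rw [← hr]
  refine ⟨_, eq_sphereVec ?_ ?_⟩
  · simp [h.lieForm_conicVec]
  · rw [compZero_smul, compZero_conicVec, inv_mul_cancel₀ h0]

end LieCyclide

/-- Curvature line parametrization of Dupin cyclides. The vectors `S i j` are homogeneous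
coordinates of three different spheres of the `i`-th cyclidic family. -/
theorem mainTheorem3 (D : DupinCyclide) (S : Fin 2 → Fin 3 → V)
    (hS : ∀ i j, S i j ≠ 0)
    (hfam : ∀ i j, Projectivization.mk ℝ (S i j) (hS i j) ∈ D.family i)
    (hne : ∀ i, Function.Injective fun j => Projectivization.mk ℝ (S i j) (hS i j)) :
    ∃ s : Fin 2 → OnePoint ℝ → ℙ ℝ V,
      -- `s i = [conicVec (S i)]` parametrizes the `i`-th cyclidic family of spheres
      (∀ i t, ∃ h : conicVec (S i) t ≠ 0, s i t = Projectivization.mk ℝ (conicVec (S i) t) h) ∧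
      (∀ i, Set.BijOn (s i) Set.univ (D.family i)) ∧
      (∀ i, s i ((0 : ℝ) : OnePoint ℝ) = Projectivization.mk ℝ (S i 0) (hS i 0) ∧
        s i ((1 / 2 : ℝ) : OnePoint ℝ) = Projectivization.mk ℝ (S i 1) (hS i 1) ∧
        s i ((1 : ℝ) : OnePoint ℝ) = Projectivization.mk ℝ (S i 2) (hS i 2)) ∧
      -- `inc[s 0 t₁, s 1 t₂]` is a curvature line parametrization by contact elements
      (∀ t₁ t₂, IsContactElement (inc (s 0 t₁) (s 1 t₂))) ∧
      Set.BijOn (fun t : OnePoint ℝ × OnePoint ℝ => inc (s 0 t.1) (s 1 t.2)) Set.univ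
        D.contactElements ∧
      (∀ (k₁ k₂ : Fin 2) (p : ℝ × ℝ), IsLieCurvatureLineParamAt
        (fun q => inc (s 0 (chart k₁ q.1)) (s 1 (chart k₂ q.2)))
        (s 0 (chart k₁ p.1)) (s 1 (chart k₂ p.2)) p) ∧
      -- the oriented radii of the spheres of the families
      (∀ i t, radiusFun (S i) t = compR (conicVec (S i) t) ∧
        scaleFun (S i) t = compZero (conicVec (S i) t) ∧
        (scaleFun (S i) t ≠ 0 → ∃ c : E3, (scaleFun (S i) t)⁻¹ • conicVec (S i) t =
          sphereVec c (radiusFun (S i) t / scaleFun (S i) t))) ∧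
      -- the unique point sphere in each contact element
      (∀ t₁ t₂, ∃ h : contactVec S t₁ t₂ ≠ 0, ∀ p : ℙ ℝ V,
        (p.submodule ≤ inc (s 0 t₁) (s 1 t₂) ∧ IsPointSphere p ↔
          p = Projectivization.mk ℝ (contactVec S t₁ t₂) h)) ∧
      (∀ t₁ t₂, contactScale S t₁ t₂ = 0 →
        Submodule.span ℝ {contactVec S t₁ t₂} = Submodule.span ℝ {eInf}) ∧
      (∀ t₁ t₂, contactScale S t₁ t₂ ≠ 0 → xHat S t₁ t₂ = pointVec (xPoint S t₁ t₂)) ∧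
      -- the formula for `x̂` in terms of normalized coordinates and oriented radii
      (∀ t₁ t₂, scaleFun (S 0) t₁ ≠ 0 → scaleFun (S 1) t₂ ≠ 0 →
        ∀ r₁ r₂ : ℝ, r₁ = radiusFun (S 0) t₁ / scaleFun (S 0) t₁ →
          r₂ = radiusFun (S 1) t₂ / scaleFun (S 1) t₂ →
          r₁ ≠ r₂ ∧ contactScale S t₁ t₂ ≠ 0 ∧
          xHat S t₁ t₂ = (r₂ - r₁)⁻¹ • (r₂ • ((scaleFun (S 0) t₁)⁻¹ • conicVec (S 0) t₁) -
            r₁ • ((scaleFun (S 1) t₂)⁻¹ • conicVec (S 1) t₂))) ∧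
      -- the Euclidean parametrization
      {x | ∃ t₁ t₂, contactScale S t₁ t₂ ≠ 0 ∧ x = xPoint S t₁ t₂} = D.points ∧
      (∃ n : OnePoint ℝ → OnePoint ℝ → E3,
        (∀ t₁ t₂, contactScale S t₁ t₂ ≠ 0 → ‖n t₁ t₂‖ = 1 ∧
          inc (s 0 t₁) (s 1 t₂) = contactElementAt (xPoint S t₁ t₂) (n t₁ t₂)) ∧
        (∀ (k₁ k₂ : Fin 2) (p : ℝ × ℝ), contactScale S (chart k₁ p.1) (chart k₂ p.2) ≠ 0 →
          ContDiffAt ℝ ((⊤ : ℕ∞) : WithTop ℕ∞)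
            (fun q : ℝ × ℝ => xPoint S (chart k₁ q.1) (chart k₂ q.2)) p ∧
          (IsCurvatureLineParamAt (fun q => xPoint S (chart k₁ q.1) (chart k₂ q.2))
              (fun q => n (chart k₁ q.1) (chart k₂ q.2)) p ↔
            ¬ IsPointSphere (s 0 (chart k₁ p.1)) ∧ ¬ IsPointSphere (s 1 (chart k₂ p.2))))) ∧
      -- unless the cyclide is a circle, all but finitely many parameter lines are regular
      (∀ i, (∃ p ∈ D.family i, ¬ IsPointSphere p) →
        {t | IsPointSphere (s i t)}.Finite) := by
  have hT (i : Fin 2) : IsConicTriple (D.P i) (S i) :=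
    (D.signature i).isConicTriple (fun j => (D.mk_mem_family (hS i j)).1 (hfam i j) |>.1)
      (fun j => (D.mk_mem_family (hS i j)).1 (hfam i j) |>.2) (hS i) (hne i)
  have hc := spansContact_conicVec hT
  refine ⟨fun i => (hT i).point, fun i t => ⟨(hT i).conicVec_ne_zero t, rfl⟩, bijOn_point hT,
    fun i => ⟨(hT i).point_eq_mk _ (conicVec_zero _), (hT i).point_eq_mk _ (conicVec_half _),
      (hT i).point_eq_mk _ (conicVec_one _)⟩, fun t₁ t₂ => ?_, bijOn_inc_point hT,
    isLieCurvatureLineParamAt_inc_point hT, fun i t => ⟨(compR_conicVec _ _).symm,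
      (compZero_conicVec _ _).symm, (hT i).exists_sphereVec⟩, fun t₁ t₂ => ?_, fun t₁ t₂ h0 => ?_,
    fun t₁ t₂ => xHat_eq_pointVec hT, fun t₁ t₂ hμ₁ hμ₂ r₁ r₂ hr₁ hr₂ => ?_, setOf_xPoint_eq hT,
    ⟨fun t₁ t₂ => spatial (planeComb (conicVec (S 0) t₁) (conicVec (S 1) t₂)),
      fun t₁ t₂ h0 => ?_, fun k₁ k₂ p h0 => ?_⟩, fun i hi => ?_⟩
  · rw [inc_point hT]
    exact (hc t₁ t₂).isContactElement
  · have h : contactVec S t₁ t₂ ≠ 0 := by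
      rw [contactVec_eq]; exact (hc t₁ t₂).pointComb_ne_zero
    exact ⟨h, pointSphere_iff hT t₁ t₂ h⟩
  · rw [contactScale_eq] at h0
    obtain ⟨c, hc0, e⟩ := (hc t₁ t₂).exists_eInf h0
    rw [contactVec_eq, e, Submodule.span_singleton_smul_eq hc0.isUnit]
  · have hν : contactScale S t₁ t₂ ≠ 0 := by
      rw [contactScale_eq]
      exact (hc t₁ t₂).compZero_pointComb_ne (by rwa [compZero_conicVec])
    -- The factorization `ν = μ₁ μ₂ (r₂ - r₁)` turns `ν ≠ 0` into `r₁ ≠ r₂`.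
    have hν' : contactScale S t₁ t₂ = scaleFun (S 0) t₁ * scaleFun (S 1) t₂ * (r₂ - r₁) := by
      rw [contactScale, hr₁, hr₂]; field_simp
    have hr : r₂ - r₁ ≠ 0 := right_ne_zero_of_mul (hν' ▸ hν)
    refine ⟨fun e => hr (by rw [e, sub_self]), hν, ?_⟩
    have e₁ : radiusFun (S 0) t₁ = r₁ * scaleFun (S 0) t₁ := by rw [hr₁]; field_simp
    have e₂ : radiusFun (S 1) t₂ = r₂ * scaleFun (S 1) t₂ := by rw [hr₂]; field_simp
    rw [xHat, hν', contactVec, e₁, e₂]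
    match_scalars <;> field_simp
  · rw [contactScale_eq] at h0
    refine ⟨(hc t₁ t₂).norm_normal h0, ?_⟩
    rw [inc_point hT, xPoint, xHat_eq]
    exact (hc t₁ t₂).span_eq_contactElementAt h0
  · have h0' := compZero_pointComb_polyVec_ne h0
    rw [xPoint_chart, planeComb_chart, (hT 0).isPointSphere_point, (hT 1).isPointSphere_point,
      ← compR_polyVec_eq_zero_iff, ← compR_polyVec_eq_zero_iff]
    exact ⟨contDiffAt_contactPoint (contDiff_polyVec _ _) (contDiff_polyVec _ _) h0',
      isCurvatureLineParamAt_contactPoint_iff (contDiff_polyVec _ _) (contDiff_polyVec _ _) h0'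
        (hasDerivAt_polyVec (S 0) k₁) (hasDerivAt_polyVec (S 1) k₂)
        fun q => D.contactMotion hT k₁ k₂ q.1 q.2⟩
  · obtain ⟨p, hp, hps⟩ := hi
    obtain ⟨t, -, rfl⟩ := (bijOn_point hT i).surjOn hp
    rw [(hT i).isPointSphere_point, compR_conicVec] at hps
    refine (finite_radiusFun_eq_zero hps).subset fun t' ht' => ?_
    rwa [Set.mem_ofPred_eq, (hT i).isPointSphere_point, compR_conicVec] at ht'
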